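/- Let $T>0$, $H\in(0,\tfrac12]$, and let $W=\{W(t,x):t\in[0,T],\,x\in\mathbb R\}$ be a centered Gaussian process that is white in time and a fractional Brownian motion with index $H$ in space, that is, $$\mathbf E\,W(t,x)W(s,y)=(t\wedge s)\,\tfrac12\big(|x|^{2H}+|y|^{2H}-|x-y|^{2H}\big).$$ Let $u_0(x)$, $x\in\mathbb R$, be a random process with (almost surely) continuous paths such that $\sup_x\|u_0(x)\|_{L^p}<\infty$ for all $p\ge2$ and, for some $\rho\in(0,1]$ and constants $L_0(p)\ge 0$, $\|u_0(x)-u_0(y)\|_{L^p}\le L_0(p)|x-y|^\rho$ for all $p\ge1$ and $x,y\in\mathbb R$, where $\|\xi\|_{L^p}=(\mathbf E|\xi|^p)^{1/p}$. Let $c_0$ be a constant with $\|u_0(x)\|_{L^2}\le c_0$ for all $x$. Consider the two components of the mild solution $u=\omega+V$ of $\partial_t u=\partial_x^2u+\partial_t\partial_xW$, $u(0,\cdot)=u_0$, on $(0,T]\times\mathbb R$: $$\omega(t,x)=\int_{\mathbb R}G_t(x-y)u_0(y)\,dy,\qquad V(t,x)=\int_0^t\!\int_{\mathbb R}G_{t-\theta}(x-\eta)\,W(d\theta,d\eta),\qquad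 G_t(x)=\frac{1}{\sqrt{4\pi t}}e^{-x^2/(4t)}.$$ Here $\int\!\int\varphi\,dW$ denotes the Wiener integral: the $L^2(\Omega)$ limit of the integrals $\sum_i c_iW(R_i)$ of step functions $\sum_i c_i1_{R_i}$ ($R_i$ rectangles in $[0,T]\times\mathbb R$, $W(R_i)$ the rectangular increments of $W$) that converge to $\varphi$ in the norm given by $\int_0^T\!\int_{\mathbb R}|F\varphi(\theta,\cdot)(\xi)|^2\,C_H|\xi|^{1-2H}\,d\xi\,d\theta$, where $Ff(\xi)=\int e^{-i\xi y}f(y)\,dy$ and $C_H=\frac{\Gamma(2H+1)\sin(\pi H)}{2\pi}$. Then $\omega(t,x)$ (as an almost surely convergent integral, belonging to $L^2(\Omega)$) and $V(t,x)$ exist for all $(t,x)\in(0,T]\times\mathbb R$, and for all $t,s\in(0,T]$ and $x,y\in\mathbb R$ $$\|\omega(t,x)\|_{L^2}\le\sup_{z\in\mathbb R}\|u_0(z)\|_{L^2}\le c_0,\qquad \|V(t,x)\|_{L^2}\le A(H)\,t^{H/2},$$ $$\|\omega(t,x)-\omega(s,y)\|_{L^2}\le c_\omega\big(|t-s|^{\rho/2}+|x-y|^\rho\big),\qquad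 \|V(t,x)-V(s,y)\|_{L^2}\le c_V\big(|t-s|^{H/2}+|x-y|^H\big).$$ The constants are $$c_\omega=\sqrt{2L\max(C_1,L)},\quad L=L_0(2),\quad C_1=\frac{4^\rho}{\sqrt\pi}\,\Gamma\big(\rho+\tfrac12\big),$$ $$A(H)=\sqrt{C_H\,\kappa_H},\quad \kappa_H=2^{H-1}\,\frac{\Gamma(1-H)}{H},\qquad c_V=\sqrt{3C_H\max(c_{1,H}+c_{2,H},\,c_{3,H})},$$ $$c_{1,H}=2^{-(H+1)}\,\frac{\Gamma(H+1)}{H},\qquad c_{2,H}=\frac12\int_{\mathbb R}\frac{(1-e^{-u^2})^2}{|u|^{1+2H}}\,du,$$ and $c_{3,H}=(2H)^{-1}\Gamma(1-2H)\cos(\pi H)$ if $H<\tfrac12$, $c_{3,1/2}=\tfrac{\pi}{2}$. -/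

import Mathlib

open MeasureTheory ProbabilityTheory Filter Topology Set
open scoped ENNReal NNReal

noncomputable section

namespace FracHeat

/-! ### The heat kernel and the deterministic part of the mild solution -/

/-- The heat kernel `G_t(x) = (4πt)^{-1/2} exp(-x²/(4t))` of `∂_t - ∂_x²` (used for `t > 0`). -/
def heatKernel (t x : ℝ) : ℝ :=
  1 / √(4 * Real.pi * t) * Real.exp (-|x| ^ 2 / (4 * t))

/-- The deterministic-kernel part `ω(t,x) = ∫ G_t(x-y) u₀(y) dy` (a pathwise integral). -/
def omegaField {Ω : Type*} (u₀ : ℝ → Ω → ℝ) (t x : ℝ) (w : Ω) : ℝ :=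
  ∫ y, heatKernel t (x - y) * u₀ y w

/-- The assumption on the initial condition: `u₀` is a process with (almost surely) continuous
paths, its `L^p` norms are bounded by `K p` for every `p ≥ 2`, and it is `ρ`-Hölder continuous in
`L^p` with constant `L₀ p` for every `p ≥ 1`. -/
structure InitialCondition {Ω : Type*} [MeasurableSpace Ω] (P : Measure Ω)
    (ρ : ℝ) (K L₀ : ℝ → ℝ≥0) (u₀ : ℝ → Ω → ℝ) : Prop where
  measurable : ∀ x, Measurable (u₀ x)
  continuous_paths : ∀ᵐ w ∂P, Continuous fun x => u₀ x w
  moments : ∀ p : ℝ, 2 ≤ p → ∀ x, eLpNorm (u₀ x) (ENNReal.ofReal p) P ≤ K p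
  holder : ∀ p : ℝ, 1 ≤ p → ∀ x y,
    eLpNorm (fun w => u₀ x w - u₀ y w) (ENNReal.ofReal p) P
      ≤ ENNReal.ofReal (L₀ p * |x - y| ^ ρ)

/-! ### The noise and its Wiener integral -/

/-- `W(t,x)`, `t ∈ [0,T]`, `x ∈ ℝ`, is a centered Gaussian process, white (Brownian) in time and a
fractional Brownian motion with index `H` in space:
`E[W(t,x) W(s,y)] = min(t,s) · (|x|^{2H} + |y|^{2H} - |x-y|^{2H})/2`. -/
structure IsFractionalNoise {Ω : Type*} [MeasurableSpace Ω] (P : Measure Ω)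
    (H T : ℝ) (W : ℝ → ℝ → Ω → ℝ) : Prop where
  gaussian : IsGaussianProcess (fun q : Icc (0 : ℝ) T × ℝ => W q.1 q.2) P
  centered : ∀ t ∈ Icc 0 T, ∀ x, ∫ w, W t x w ∂P = 0
  covariance : ∀ t ∈ Icc 0 T, ∀ s ∈ Icc 0 T, ∀ x y,
    ∫ w, W t x w * W s y w ∂P
      = min t s * ((|x| ^ (2 * H) + |y| ^ (2 * H) - |x - y| ^ (2 * H)) / 2)

/-- A rectangle `(s,t] × (a,b]` with `0 ≤ s ≤ t ≤ T` and `a ≤ b`. -/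
structure Rect (T : ℝ) where
  s : ℝ
  t : ℝ
  a : ℝ
  b : ℝ
  s_nonneg : 0 ≤ s
  s_le_t : s ≤ t
  t_le : t ≤ T
  a_le_b : a ≤ b

/-- The indicator function of a rectangle. -/
def Rect.ind {T : ℝ} (R : Rect T) (θ η : ℝ) : ℝ :=
  (Ioc R.s R.t ×ˢ Ioc R.a R.b).indicator 1 (θ, η)

/-- The rectangular increment `W((s,t] × (a,b])`. -/
def Rect.increment {Ω : Type*} {T : ℝ} (W : ℝ → ℝ → Ω → ℝ) (R : Rect T) (w : Ω) : ℝ :=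
  W R.t R.b w - W R.t R.a w - W R.s R.b w + W R.s R.a w

/-- The step function `∑ c_R 1_R` given by a finitely supported family of coefficients. -/
def stepFun (T : ℝ) : (Rect T →₀ ℝ) →ₗ[ℝ] (ℝ → ℝ → ℝ) :=
  Finsupp.linearCombination ℝ Rect.ind

/-- The elementary integral `∑ c_R W(R)` of the step function `∑ c_R 1_R`. -/
def stepIntegral {Ω : Type*} (T : ℝ) (W : ℝ → ℝ → Ω → ℝ) : (Rect T →₀ ℝ) →ₗ[ℝ] (Ω → ℝ) :=
  Finsupp.linearCombination ℝ (Rect.increment W)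

/-- The Fourier transform `Ff(ξ) = ∫ e^{-iξy} f(y) dy`. -/
def fourierT (f : ℝ → ℝ) (ξ : ℝ) : ℂ :=
  ∫ y : ℝ, Complex.exp (-(Complex.I * ξ * y)) * f y

/-- `C_H = Γ(2H+1) sin(πH) / (2π)`. -/
def CH (H : ℝ) : ℝ := Real.Gamma (2 * H + 1) * Real.sin (Real.pi * H) / (2 * Real.pi)

/-- The spectral measure `μ(dξ) = C_H |ξ|^{1-2H} dξ` of the noise. -/
def spectralMeasure (H : ℝ) : Measure ℝ :=
  volume.withDensity fun ξ => ENNReal.ofReal (CH H * |ξ| ^ (1 - 2 * H))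

/-- The squared norm `∫_0^T ∫ |Fφ(θ,·)(ξ)|² μ(dξ) dθ` of the space of integrands. -/
def integrandNormSq (H T : ℝ) (φ : ℝ → ℝ → ℝ) : ℝ≥0∞ :=
  ∫⁻ θ in Icc 0 T, ∫⁻ ξ, ‖fourierT (φ θ) ξ‖ₑ ^ 2 ∂(spectralMeasure H)

/-- `I = ∫_0^T ∫ φ(θ,η) W(dθ,dη)`: the random variable `I` is the `L²(P)` limit of the elementary
integrals of step functions that converge to `φ` in the norm of the space of integrands. -/
structure IsWienerIntegral {Ω : Type*} [MeasurableSpace Ω] (P : Measure Ω)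
    (H T : ℝ) (W : ℝ → ℝ → Ω → ℝ) (φ : ℝ → ℝ → ℝ) (I : Ω → ℝ) : Prop where
  measurable_integrand : Measurable (Function.uncurry φ)
  integrable_integrand : ∀ θ ∈ Icc 0 T, Integrable (φ θ)
  memLp : MemLp I 2 P
  exists_approx : ∃ f : ℕ → (Rect T →₀ ℝ),
    Tendsto (fun n => integrandNormSq H T (φ - stepFun T (f n))) atTop (𝓝 0) ∧
    Tendsto (fun n => eLpNorm (I - stepIntegral T W (f n)) 2 P) atTop (𝓝 0)

/-- The integrand `(θ,η) ↦ 1_{[0,t)}(θ) G_{t-θ}(x-η)` of the stochastic convolution. -/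
def convKernel (t x θ η : ℝ) : ℝ :=
  (Ico 0 t).indicator (fun θ => heatKernel (t - θ) (x - η)) θ

/-- `V(t,x) = ∫_0^t ∫ G_{t-θ}(x-η) W(dθ,dη)` for all `(t,x) ∈ (0,T] × ℝ`. -/
def IsStochasticConvolution {Ω : Type*} [MeasurableSpace Ω] (P : Measure Ω)
    (H T : ℝ) (W V : ℝ → ℝ → Ω → ℝ) : Prop :=
  ∀ t ∈ Ioc 0 T, ∀ x, IsWienerIntegral P H T W (convKernel t x) (V t x)

/-! ### The constants -/

/-- `C₁ = 4^ρ Γ(ρ + 1/2) / √π`. -/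
def C1 (ρ : ℝ) : ℝ := (4 : ℝ) ^ ρ / √Real.pi * Real.Gamma (ρ + 1 / 2)

/-- `c_ω = √(2 L max(C₁, L))`, where `L = L₀(2)`. -/
def cOmega (ρ L : ℝ) : ℝ := √(2 * L * max (C1 ρ) L)

/-- The coefficient `2^{H-1} Γ(1-H) / H` in
`∫_0^t ∫ exp(-2sξ²) |ξ|^{1-2H} dξ ds = 2^{H-1} Γ(1-H) / H · t^H`. -/
def kappaH (H : ℝ) : ℝ := (2 : ℝ) ^ (H - 1) * (Real.Gamma (1 - H) / H)

/-- `A(H) = √(C_H κ_H)`, where `κ_H = 2^{H-1} Γ(1-H) / H`. -/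
def AH (H : ℝ) : ℝ := √(CH H * kappaH H)

/-- `c_{1,H} = 2^{-(H+1)} Γ(H+1) / H`. -/
def c1H (H : ℝ) : ℝ := (2 : ℝ) ^ (-(H + 1)) * (Real.Gamma (H + 1) / H)

/-- `c_{2,H} = (1/2) ∫_ℝ (1 - exp(-u²))² / |u|^{1+2H} du`. -/
def c2H (H : ℝ) : ℝ := 1 / 2 * ∫ u : ℝ, (1 - Real.exp (-u ^ 2)) ^ 2 / |u| ^ (1 + 2 * H)

open Classical in
/-- `c_{3,H} = (2H)^{-1} Γ(1-2H) cos(πH)` for `H < 1/2`, and `c_{3,1/2} = π/2`. -/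
def c3H (H : ℝ) : ℝ :=
  if H < 1 / 2 then (2 * H)⁻¹ * Real.Gamma (1 - 2 * H) * Real.cos (H * Real.pi)
  else Real.pi / 2

/-- `c_V = √(3 C_H max(c_{1,H} + c_{2,H}, c_{3,H}))`. -/
def cV (H : ℝ) : ℝ := √(3 * CH H * max (c1H H + c2H H) (c3H H))

end FracHeat

end

noncomputable section

namespace FracHeat

/-! ### Preliminaries on `L²` norms -/

/-! The two components are treated by unrelated means.

For `ω`, the heat kernel is the density of `x + √(2t) Z` with `Z` standard normal, so `ω(t,x)` is
the average of `u₀(x + √(2t) Z)` over a `Z` independent of the randomness of `u₀`. Using the same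
`Z` at `(t,x)` and `(s,y)` couples the two averages. Minkowski's inequality and the Hölder bound on
`u₀` leave `L² E|(x-y) + cZ|^{2ρ}` with `c = √(2t) - √(2s)`. By Jensen this is at most `L² ((x-y)² +
c²)^ρ`, and `c² ≤ 2|t-s|`. The resulting constant `√2 L` is already below `cOmega`, whatever `C1`
is.

For `V`, the elementary integral is an isometry from step functions, normed on the Fourier side,
into `L²(P)`: increments of `W` and Fourier transforms of rectangles have the same Gram matrix. This
rests on `lintegral_one_sub_cos`, the spectral representation of `|x|^{2H}`. The constant there
comes from averaging over a Gaussian `x`, which turns the cosine into an exponential. The isometry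
passes to limits as a contraction (`IsWienerIntegral.eLpNorm_sq_le`), so every bound on `V` is a
bound on the norm of a kernel. For fixed `ξ` the time integral is elementary, and the `ξ`-integral
is either `lintegral_one_sub_exp` or `lintegral_one_sub_cos`.

These computations give the squared constants `CH Γ(1-H)/H` in time and `1/2` in space.
`Gamma_div_le` and `CH_mul_c3H` compare them with `cV`; the restriction `H ≤ 1/2` serves only this
comparison, all the rest needing `0 < H < 1`.

Existence of `V` requires approximating the kernel by step functions (`stepApprox_convKernel`). In
space the Gaussian is cut into horizontal layers, in time it is frozen at left endpoints; both
choices are made so that dominated convergence applies. Completeness of `L²(P)` then yields the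
integral. -/

lemma sq_eLpNorm_two {α E : Type*} [MeasurableSpace α] [NormedAddCommGroup E] (μ : Measure α)
    (f : α → E) : eLpNorm f 2 μ ^ 2 = ∫⁻ a, ‖f a‖ₑ ^ 2 ∂μ := by
  have h := eLpNorm_nnreal_pow_eq_lintegral (μ := μ) (f := f) (p := 2) two_ne_zero
  simpa using h

lemma eLpNorm_two_le_iff {α E : Type*} [MeasurableSpace α] [NormedAddCommGroup E] (μ : Measure α)
    (f : α → E) (c : ℝ≥0∞) : eLpNorm f 2 μ ≤ c ↔ ∫⁻ a, ‖f a‖ₑ ^ 2 ∂μ ≤ c ^ 2 := by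
  rw [← sq_eLpNorm_two]
  exact (ENNReal.pow_le_pow_left_iff two_ne_zero).symm

lemma enorm_integral_sq_le {α : Type*} [MeasurableSpace α] (μ : Measure α) [IsProbabilityMeasure μ]
    {f : α → ℝ} (hf : AEStronglyMeasurable f μ) :
    ‖∫ a, f a ∂μ‖ₑ ^ 2 ≤ ∫⁻ a, ‖f a‖ₑ ^ 2 ∂μ := by
  rw [← sq_eLpNorm_two]
  gcongr
  calc ‖∫ a, f a ∂μ‖ₑ ≤ ∫⁻ a, ‖f a‖ₑ ∂μ := enorm_integral_le_lintegral_enorm _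
    _ = eLpNorm f 1 μ := eLpNorm_one_eq_lintegral_enorm.symm
    _ ≤ eLpNorm f 2 μ := eLpNorm_le_eLpNorm_of_exponent_le (by norm_num) hf

/-- Minkowski's integral inequality in `L²`, in squared form, for a probability average. -/
lemma lintegral_enorm_integral_sq_le {Ω α : Type*} [MeasurableSpace Ω] [MeasurableSpace α]
    (P : Measure Ω) [SFinite P] (μ : Measure α) [IsProbabilityMeasure μ] {D : α → Ω → ℝ}
    (hD : Measurable (Function.uncurry D)) :
    ∫⁻ w, ‖∫ z, D z w ∂μ‖ₑ ^ 2 ∂P ≤ ∫⁻ z, ∫⁻ w, ‖D z w‖ₑ ^ 2 ∂P ∂μ := by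
  rw [lintegral_lintegral_swap]
  · refine lintegral_mono fun w => enorm_integral_sq_le μ ?_
    exact (hD.comp (measurable_id.prodMk measurable_const)).aestronglyMeasurable
  · exact (hD.enorm.pow_const 2).aemeasurable

/-- Monotonicity of `L^p` norms on a probability space, for the exponents `2ρ ≤ 2`. It trades the
fractional Gaussian moment for the second moment, which is explicit. -/
lemma lintegral_rpow_le_rpow_lintegral {α : Type*} [MeasurableSpace α] (μ : Measure α)
    [IsProbabilityMeasure μ] {f : α → ℝ} (hf : AEStronglyMeasurable f μ) {ρ : ℝ} (h0 : 0 < ρ)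
    (h1 : ρ ≤ 1) :
    ∫⁻ a, ‖f a‖ₑ ^ (2 * ρ) ∂μ ≤ (∫⁻ a, ‖f a‖ₑ ^ 2 ∂μ) ^ ρ := by
  lift ρ to ℝ≥0 using h0.le
  have h0' : 0 < ρ := by exact_mod_cast h0
  have h2 : (2 * ρ : ℝ≥0) ≠ 0 := by positivity
  have h := eLpNorm_nnreal_pow_eq_lintegral (μ := μ) (f := f) (p := 2 * ρ) h2
  have hle : eLpNorm f ((2 * ρ : ℝ≥0) : ℝ≥0∞) μ ≤ eLpNorm f 2 μ := by
    refine eLpNorm_le_eLpNorm_of_exponent_le ?_ hf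
    have : 2 * ρ ≤ 2 := by
      have : ρ ≤ 1 := by exact_mod_cast h1
      calc 2 * ρ ≤ 2 * 1 := by gcongr
        _ = 2 := mul_one 2
    exact_mod_cast this
  push_cast at h hle
  rw [← h, ← sq_eLpNorm_two, ← ENNReal.rpow_natCast, ← ENNReal.rpow_mul]
  push_cast
  gcongr

/-! ### The deterministic part of the mild solution -/

lemma heatKernel_eq_gaussianPDFReal {t : ℝ} (ht : 0 < t) (x y : ℝ) :
    heatKernel t (x - y) = gaussianPDFReal x (NNReal.mk (2 * t) (by positivity)) y := by
  unfold heatKernel gaussianPDFReal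
  simp only [NNReal.coe_mk, sq_abs, one_div]
  congr 2
  · congr 1; ring
  · rw [show (x - y) ^ 2 = (y - x) ^ 2 by ring]; congr 1; ring

lemma gaussianReal_map_affine (x c : ℝ) :
    (gaussianReal 0 1).map (fun z => x + c * z) = gaussianReal x (NNReal.mk (c ^ 2) (sq_nonneg c)) := by
  have h := gaussianReal_map_const_mul (μ := 0) (v := 1) c
  have h2 := gaussianReal_map_const_add (μ := c * 0) (v := (NNReal.mk (c ^ 2) (sq_nonneg c)) * 1) x
  rw [← h, Measure.map_map (by fun_prop) (by fun_prop)] at h2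
  simpa [Function.comp_def] using h2

lemma gaussianReal_eq_map {t : ℝ} (ht : 0 < t) (x : ℝ) :
    gaussianReal x (NNReal.mk (2 * t) (by positivity))
      = (gaussianReal 0 1).map (fun z => x + √(2 * t) * z) := by
  rw [gaussianReal_map_affine]
  congr 1
  ext
  rw [NNReal.coe_mk, NNReal.coe_mk, Real.sq_sqrt (by positivity)]

lemma integral_heatKernel_mul {t : ℝ} (ht : 0 < t) (x : ℝ) {f : ℝ → ℝ} (hf : Continuous f) :
    ∫ y, heatKernel t (x - y) * f y = ∫ z, f (x + √(2 * t) * z) ∂(gaussianReal 0 1) := by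
  have hv : ((NNReal.mk (2 * t) (by positivity)) : ℝ≥0) ≠ 0 := by
    intro h; have := congrArg NNReal.toReal h; simp at this; linarith
  have h := integral_gaussianReal_eq_integral_smul (μ := x) (v := (NNReal.mk (2 * t) (by positivity)))
    (f := f) hv
  simp only [heatKernel_eq_gaussianPDFReal ht]
  simp only [smul_eq_mul] at h
  rw [← h, gaussianReal_eq_map ht, integral_map (by fun_prop) hf.aestronglyMeasurable]

lemma integrable_heatKernel_mul_iff {t : ℝ} (ht : 0 < t) (x : ℝ) {f : ℝ → ℝ} (hf : Continuous f) :
    Integrable (fun y => heatKernel t (x - y) * f y) ↔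
      Integrable (fun z => f (x + √(2 * t) * z)) (gaussianReal 0 1) := by
  have hv : ((NNReal.mk (2 * t) (by positivity)) : ℝ≥0) ≠ 0 := by
    intro h; have := congrArg NNReal.toReal h; simp at this; linarith
  have h1 := integrable_map_measure (μ := gaussianReal 0 1) (f := fun z => x + √(2 * t) * z)
    (g := f) hf.aestronglyMeasurable (by fun_prop)
  rw [← gaussianReal_eq_map ht, gaussianReal_of_var_ne_zero _ hv,
    integrable_withDensity_iff_integrable_smul' (by fun_prop) (by simp [gaussianPDF])] at h1
  refine Iff.trans ?_ h1
  simp [heatKernel_eq_gaussianPDFReal ht, toReal_gaussianPDF]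

lemma lintegral_affine_sq_gaussianReal (a c : ℝ) :
    ∫⁻ z, ‖a + c * z‖ₑ ^ 2 ∂(gaussianReal 0 1) = ENNReal.ofReal (a ^ 2 + c ^ 2) := by
  have h1 : ∫⁻ z, ‖a + c * z‖ₑ ^ 2 ∂(gaussianReal 0 1)
      = ∫⁻ z, ENNReal.ofReal (z ^ 2) ∂(gaussianReal a (NNReal.mk (c ^ 2) (sq_nonneg c))) := by
    rw [← gaussianReal_map_affine, lintegral_map (by fun_prop) (by fun_prop)]
    refine lintegral_congr fun z => ?_
    rw [← ofReal_norm, ← ENNReal.ofReal_pow (norm_nonneg _), Real.norm_eq_abs, sq_abs]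
  have hm := memLp_id_gaussianReal (μ := a) (v := (NNReal.mk (c ^ 2) (sq_nonneg c))) 2
  rw [h1, ← ofReal_integral_eq_lintegral_ofReal]
  · congr 1
    have h2 := variance_eq_sub hm
    rw [variance_id_gaussianReal] at h2
    simp only [id, integral_id_gaussianReal, Pi.pow_apply, NNReal.coe_mk] at h2
    linarith
  · exact hm.integrable_sq
  · exact ae_of_all _ fun z => sq_nonneg z

/-- A version of the initial condition that is jointly measurable with continuous paths. -/
lemma InitialCondition.exists_version {Ω : Type*} [MeasurableSpace Ω] {P : Measure Ω} {ρ : ℝ}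
    {K L₀ : ℝ → ℝ≥0} {u₀ : ℝ → Ω → ℝ} (h : InitialCondition P ρ K L₀ u₀) :
    ∃ v : ℝ → Ω → ℝ, Measurable (Function.uncurry v) ∧ (∀ w, Continuous fun x => v x w) ∧
      ∀ᵐ w ∂P, ∀ x, u₀ x w = v x w := by
  obtain ⟨s, hs, hsm, hs0⟩ := exists_measurable_superset_of_null h.continuous_paths
  classical
  -- The process is set to zero on a measurable null set containing all discontinuous paths.
  -- Continuity in `x` then holds for every `w` and, with measurability in `w`, gives joint
  -- measurability. Agreement with `u₀` holds off one null set common to all `x`.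
  refine ⟨fun x => sᶜ.indicator (u₀ x), ?_, fun w => ?_, ?_⟩
  · refine measurable_uncurry_of_continuous_of_measurable (fun w => ?_)
      (fun x => (h.measurable x).indicator hsm.compl)
    by_cases hw : w ∈ s
    · simpa [hw] using continuous_const
    · have : Continuous fun x => u₀ x w := by_contra fun hc => hw (hs hc)
      simpa [hw] using this
  · by_cases hw : w ∈ s
    · simpa [hw] using continuous_const
    · have : Continuous fun x => u₀ x w := by_contra fun hc => hw (hs hc)
      simpa [hw] using this
  · filter_upwards [measure_eq_zero_iff_ae_notMem.1 hs0] with w hw x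
    simp [hw]

lemma InitialCondition.lintegral_sub_sq_le {Ω : Type*} [MeasurableSpace Ω] {P : Measure Ω} {ρ : ℝ}
    {K L₀ : ℝ → ℝ≥0} {u₀ : ℝ → Ω → ℝ} (h : InitialCondition P ρ K L₀ u₀) (hρ : 0 < ρ) (x y : ℝ) :
    ∫⁻ w, ‖u₀ x w - u₀ y w‖ₑ ^ 2 ∂P ≤ (L₀ 2 : ℝ≥0∞) ^ 2 * ‖x - y‖ₑ ^ (2 * ρ) := by
  have h2 := h.holder 2 (by norm_num) x y
  rw [ENNReal.ofReal_ofNat, eLpNorm_two_le_iff] at h2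
  refine h2.trans_eq ?_
  rw [ENNReal.ofReal_mul (by positivity), mul_pow, ENNReal.ofReal_coe_nnreal,
    ← ENNReal.ofReal_rpow_of_nonneg (abs_nonneg _) hρ.le, ← Real.norm_eq_abs,
    ofReal_norm, mul_comm 2 ρ, ENNReal.rpow_mul, ENNReal.rpow_ofNat]

/-- The random field `ω` written as a Gaussian average of a regular version of `u₀`. -/
lemma omegaField_eq {Ω : Type*} {u₀ v : ℝ → Ω → ℝ} {w : Ω} (hv : Continuous fun x => v x w)
    (h : ∀ x, u₀ x w = v x w) {t : ℝ} (ht : 0 < t) (x : ℝ) :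
    omegaField u₀ t x w = ∫ z, v (x + √(2 * t) * z) w ∂(gaussianReal 0 1) := by
  simp only [omegaField, h]
  exact integral_heatKernel_mul ht x hv

/-- Only the second branch of the maximum is needed: `2 L max(C₁, L) ≥ 2 L²`. -/
lemma sqrt_two_mul_le_cOmega (ρ : ℝ) (L : ℝ≥0) : √2 * L ≤ cOmega ρ L := by
  refine Real.le_sqrt_of_sq_le ?_
  rw [mul_pow, Real.sq_sqrt zero_le_two]
  nlinarith [le_max_right (C1 ρ) (L : ℝ), L.coe_nonneg,
    mul_le_mul_of_nonneg_left (le_max_right (C1 ρ) (L : ℝ)) L.coe_nonneg]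

lemma sq_sqrt_sub_sqrt_le {t s : ℝ} (ht : 0 ≤ t) (hs : 0 ≤ s) :
    (√(2 * t) - √(2 * s)) ^ 2 ≤ 2 * |t - s| := by
  have h1 := Real.sq_sqrt (by positivity : 0 ≤ 2 * t)
  have h2 := Real.sq_sqrt (by positivity : 0 ≤ 2 * s)
  have h3 := Real.sqrt_nonneg (2 * t)
  have h4 := Real.sqrt_nonneg (2 * s)
  rcases le_total s t with h | h
  · rw [abs_of_nonneg (by linarith)]
    have : √(2 * s) ≤ √(2 * t) := Real.sqrt_le_sqrt (by linarith)
    nlinarith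
  · rw [abs_of_nonpos (by linarith)]
    have : √(2 * t) ≤ √(2 * s) := Real.sqrt_le_sqrt (by linarith)
    nlinarith

/-- Subadditivity of `r ↦ r^ρ` together with `2^ρ ≤ 2`. It is applied with `a = |t-s|`, `b = |x-y|`
and `c = (√(2t) - √(2s))²`. -/
lemma add_sq_rpow_le {ρ : ℝ} (h0 : 0 < ρ) (h1 : ρ ≤ 1) {a b c : ℝ} (ha : 0 ≤ a) (hb : 0 ≤ b)
    (hc0 : 0 ≤ c) (hc : c ≤ 2 * a) : (b ^ 2 + c) ^ ρ ≤ 2 * (a ^ (ρ / 2) + b ^ ρ) ^ 2 := by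
  have h : 0 ≤ b ^ 2 + c := by positivity
  have h2a : 0 ≤ 2 * a := by positivity
  have e1 : (b ^ 2 + 2 * a) ^ ρ ≤ (b ^ 2) ^ ρ + (2 * a) ^ ρ :=
    Real.rpow_add_le_add_rpow (sq_nonneg b) h2a h0.le h1
  have e2 : (b ^ 2) ^ ρ = (b ^ ρ) ^ 2 := by
    rw [← Real.rpow_natCast, ← Real.rpow_natCast, ← Real.rpow_mul hb, ← Real.rpow_mul hb, mul_comm]
  have e3 : (2 * a) ^ ρ ≤ 2 * (a ^ (ρ / 2)) ^ 2 := by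
    rw [Real.mul_rpow zero_le_two ha, ← Real.rpow_natCast, ← Real.rpow_mul ha]
    have : (2 : ℝ) ^ ρ ≤ 2 ^ (1 : ℝ) := Real.rpow_le_rpow_of_exponent_le one_le_two h1
    rw [Real.rpow_one] at this
    have e : ρ / 2 * ((2 : ℕ) : ℝ) = ρ := by push_cast; ring
    rw [e]
    gcongr
  have e4 : (b ^ 2 + c) ^ ρ ≤ (b ^ 2 + 2 * a) ^ ρ := Real.rpow_le_rpow h (by linarith) h0.le
  have := Real.rpow_nonneg ha (ρ / 2)
  have := Real.rpow_nonneg hb ρ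
  nlinarith [mul_nonneg ‹0 ≤ a ^ (ρ / 2)› ‹0 ≤ b ^ ρ›]

section omega

variable {Ω : Type*} [MeasurableSpace Ω] {P : Measure Ω} {ρ : ℝ}
  {K L₀ : ℝ → ℝ≥0} {u₀ : ℝ → Ω → ℝ}

lemma InitialCondition.iSup_eLpNorm_le (h : InitialCondition P ρ K L₀ u₀) :
    ⨆ z, eLpNorm (u₀ z) 2 P ≤ K 2 := by
  refine iSup_le fun z => ?_
  simpa using h.moments 2 le_rfl z

lemma measurable_comp_affine {v : ℝ → Ω → ℝ} (hv : Measurable (Function.uncurry v)) (x c : ℝ) :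
    Measurable (Function.uncurry fun (z : ℝ) (w : Ω) => v (x + c * z) w) :=
  hv.comp (f := fun q : ℝ × Ω => (x + c * q.1, q.2)) (by fun_prop)

lemma lintegral_version_sq_le {v : ℝ → Ω → ℝ} (hu : ∀ᵐ w ∂P, ∀ x, u₀ x w = v x w) (x c : ℝ) :
    ∫⁻ z, ∫⁻ w, ‖v (x + c * z) w‖ₑ ^ 2 ∂P ∂(gaussianReal 0 1)
      ≤ (⨆ z, eLpNorm (u₀ z) 2 P) ^ 2 := by
  calc ∫⁻ z, ∫⁻ w, ‖v (x + c * z) w‖ₑ ^ 2 ∂P ∂(gaussianReal 0 1)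
      ≤ ∫⁻ _, (⨆ z, eLpNorm (u₀ z) 2 P) ^ 2 ∂(gaussianReal 0 1) := by
        refine lintegral_mono fun z => ?_
        rw [← eLpNorm_two_le_iff P (fun w => v (x + c * z) w)]
        refine le_trans (eLpNorm_congr_ae ?_).le 
          (le_iSup (fun z => eLpNorm (u₀ z) 2 P) (x + c * z))
        filter_upwards [hu] with w hw
        exact (hw _).symm
    _ = _ := by simp

variable [IsProbabilityMeasure P]

lemma InitialCondition.eLpNorm_omegaField_le (h : InitialCondition P ρ K L₀ u₀) {t : ℝ}
    (ht : 0 < t) (x : ℝ) :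
    eLpNorm (omegaField u₀ t x) 2 P ≤ ⨆ z, eLpNorm (u₀ z) 2 P := by
  obtain ⟨v, hvm, hvc, hu⟩ := h.exists_version
  rw [eLpNorm_two_le_iff]
  calc ∫⁻ w, ‖omegaField u₀ t x w‖ₑ ^ 2 ∂P
      = ∫⁻ w, ‖∫ z, v (x + √(2 * t) * z) w ∂(gaussianReal 0 1)‖ₑ ^ 2 ∂P := by
        refine lintegral_congr_ae ?_
        filter_upwards [hu] with w hw
        rw [omegaField_eq (hvc w) hw ht]
    _ ≤ _ := (lintegral_enorm_integral_sq_le P _ (measurable_comp_affine hvm _ _)).trans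
        (lintegral_version_sq_le hu _ _)

lemma InitialCondition.ae_integrable_version (h : InitialCondition P ρ K L₀ u₀) {v : ℝ → Ω → ℝ}
    (hvm : Measurable (Function.uncurry v)) (hu : ∀ᵐ w ∂P, ∀ x, u₀ x w = v x w) (x c : ℝ) :
    ∀ᵐ w ∂P, Integrable (fun z => v (x + c * z) w) (gaussianReal 0 1) := by
  have hm := measurable_comp_affine hvm x c
  have h1 := lintegral_version_sq_le hu x c
  rw [lintegral_lintegral_swap (hm.enorm.pow_const 2).aemeasurable] at h1
  -- The second moment over both variables is finite, so almost every path is square integrable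
  -- against the Gaussian, hence integrable.
  have h2 : ∫⁻ w, ∫⁻ z, ‖v (x + c * z) w‖ₑ ^ 2 ∂(gaussianReal 0 1) ∂P ≠ ∞ := by
    refine ne_top_of_le_ne_top ?_ (h1.trans (pow_le_pow_left' h.iSup_eLpNorm_le 2))
    simp
  have h3 : Measurable fun w => ∫⁻ z, ‖v (x + c * z) w‖ₑ ^ 2 ∂(gaussianReal 0 1) :=
    (hm.enorm.pow_const 2).lintegral_prod_left'
  filter_upwards [ae_lt_top h3 h2] with w hw
  have hmw : AEStronglyMeasurable (fun z => v (x + c * z) w) (gaussianReal 0 1) :=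
    (hm.comp (measurable_id.prodMk measurable_const)).aestronglyMeasurable
  refine MemLp.integrable (q := 2) (by norm_num) ⟨hmw, ?_⟩
  rw [← sq_eLpNorm_two] at hw
  by_contra hc
  simp only [not_lt, top_le_iff] at hc
  simp [hc] at hw

lemma InitialCondition.ae_integrable (h : InitialCondition P ρ K L₀ u₀) {t : ℝ} (ht : 0 < t)
    (x : ℝ) : ∀ᵐ w ∂P, Integrable fun y => heatKernel t (x - y) * u₀ y w := by
  obtain ⟨v, hvm, hvc, hu⟩ := h.exists_version
  filter_upwards [hu, h.ae_integrable_version hvm hu x √(2 * t)] with w hw hi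
  simp only [hw]
  exact (integrable_heatKernel_mul_iff ht x (hvc w)).2 hi

lemma InitialCondition.memLp_omegaField (h : InitialCondition P ρ K L₀ u₀) {t : ℝ} (ht : 0 < t)
    (x : ℝ) : MemLp (omegaField u₀ t x) 2 P := by
  obtain ⟨v, hvm, hvc, hu⟩ := h.exists_version
  refine ⟨?_, ?_⟩
  · have hm := (measurable_comp_affine hvm x √(2 * t)).stronglyMeasurable
    refine (hm.integral_prod_left' (μ := gaussianReal 0 1)).aestronglyMeasurable.congr ?_
    filter_upwards [hu] with w hw
    rw [omegaField_eq (hvc w) hw ht]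
    rfl
  · exact ((h.eLpNorm_omegaField_le ht x).trans h.iSup_eLpNorm_le).trans_lt ENNReal.coe_lt_top

lemma InitialCondition.eLpNorm_omegaField_sub_le (h : InitialCondition P ρ K L₀ u₀)
    (hρ0 : 0 < ρ) (hρ1 : ρ ≤ 1) {t s : ℝ} (ht : 0 < t) (hs : 0 < s) (x y : ℝ) :
    eLpNorm (fun w => omegaField u₀ t x w - omegaField u₀ s y w) 2 P
      ≤ ENNReal.ofReal (cOmega ρ (L₀ 2) * (|t - s| ^ (ρ / 2) + |x - y| ^ ρ)) := by
  obtain ⟨v, hvm, hvc, hu⟩ := h.exists_version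
  set a := |t - s| ^ (ρ / 2) + |x - y| ^ ρ with ha
  have ha0 : 0 ≤ a := by positivity
  refine le_trans ?_ (ENNReal.ofReal_le_ofReal
    (mul_le_mul_of_nonneg_right (sqrt_two_mul_le_cOmega ρ (L₀ 2)) ha0))
  rw [eLpNorm_two_le_iff]
  set c := √(2 * t) - √(2 * s) with hc
  calc ∫⁻ w, ‖omegaField u₀ t x w - omegaField u₀ s y w‖ₑ ^ 2 ∂P
      -- The coupling: both fields are averages over the same `z`, so their difference is one
      -- average of increments of `v`.
      = ∫⁻ w, ‖∫ z, (v (x + √(2 * t) * z) w - v (y + √(2 * s) * z) w)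
          ∂(gaussianReal 0 1)‖ₑ ^ 2 ∂P := by
        refine lintegral_congr_ae ?_
        filter_upwards [hu, h.ae_integrable_version hvm hu x √(2 * t),
          h.ae_integrable_version hvm hu y √(2 * s)] with w hw h1 h2
        rw [omegaField_eq (hvc w) hw ht, omegaField_eq (hvc w) hw hs, integral_sub h1 h2]
    _ ≤ ∫⁻ z, ∫⁻ w, ‖v (x + √(2 * t) * z) w - v (y + √(2 * s) * z) w‖ₑ ^ 2 ∂P
          ∂(gaussianReal 0 1) :=
        lintegral_enorm_integral_sq_le P _
          ((measurable_comp_affine hvm _ _).sub (measurable_comp_affine hvm _ _))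
    _ ≤ ∫⁻ z, (L₀ 2 : ℝ≥0∞) ^ 2 * ‖(x - y) + c * z‖ₑ ^ (2 * ρ) ∂(gaussianReal 0 1) := by
        refine lintegral_mono fun z => ?_
        have h1 := h.lintegral_sub_sq_le hρ0 (x + √(2 * t) * z) (y + √(2 * s) * z)
        rw [show x + √(2 * t) * z - (y + √(2 * s) * z) = (x - y) + c * z by rw [hc]; ring] at h1
        refine le_trans (lintegral_congr_ae ?_).le h1
        filter_upwards [hu] with w hw
        rw [hw, hw]
    _ = (L₀ 2 : ℝ≥0∞) ^ 2 * ∫⁻ z, ‖(x - y) + c * z‖ₑ ^ (2 * ρ) ∂(gaussianReal 0 1) :=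
        lintegral_const_mul _ (by fun_prop)
    _ ≤ (L₀ 2 : ℝ≥0∞) ^ 2 * ENNReal.ofReal (((x - y) ^ 2 + c ^ 2) ^ ρ) := by
        gcongr
        refine (lintegral_rpow_le_rpow_lintegral _ (by fun_prop) hρ0 hρ1).trans_eq ?_
        rw [lintegral_affine_sq_gaussianReal, ENNReal.ofReal_rpow_of_nonneg (by positivity) hρ0.le]
    _ ≤ (L₀ 2 : ℝ≥0∞) ^ 2 * ENNReal.ofReal (2 * a ^ 2) := by
        gcongr
        have h2 := add_sq_rpow_le hρ0 hρ1 (abs_nonneg (t - s)) (abs_nonneg (x - y))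
          (sq_nonneg c) (sq_sqrt_sub_sqrt_le ht.le hs.le)
        rw [sq_abs] at h2
        exact h2
    _ = ENNReal.ofReal (√2 * L₀ 2 * a) ^ 2 := by
        rw [← ENNReal.ofReal_pow (by positivity), mul_pow, mul_pow, Real.sq_sqrt zero_le_two,
          mul_right_comm, ENNReal.ofReal_mul (p := 2 * a ^ 2) (by positivity),
          ENNReal.ofReal_pow (L₀ 2).coe_nonneg, ENNReal.ofReal_coe_nnreal, mul_comm]

end omega

/-! ### Spectral integrals -/

lemma lintegral_abs_rpow_mul_exp {q b : ℝ} (hq : -1 < q) (hb : 0 < b) :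
    ∫⁻ ξ : ℝ, ENNReal.ofReal (|ξ| ^ q * Real.exp (-b * ξ ^ 2))
      = ENNReal.ofReal (b ^ (-(q + 1) / 2) * Real.Gamma ((q + 1) / 2)) := by
  have hG : 0 < Real.Gamma ((q + 1) / 2) := Real.Gamma_pos_of_pos (by linarith)
  have h1 : ∫ ξ : ℝ, |ξ| ^ q * Real.exp (-b * ξ ^ 2)
      = b ^ (-(q + 1) / 2) * Real.Gamma ((q + 1) / 2) := by
    have h2 := integral_comp_abs (f := fun x : ℝ => x ^ q * Real.exp (-b * x ^ (2 : ℝ)))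
    rw [integral_rpow_mul_exp_neg_mul_rpow zero_lt_two hq hb] at h2
    simp only [Real.rpow_two, sq_abs] at h2
    rw [h2]; ring
  rw [← h1, ofReal_integral_eq_lintegral_ofReal]
  -- A non-integrable function has Bochner integral zero, so the nonzero closed form already proves
  -- integrability.
  · refine Integrable.of_integral_ne_zero ?_
    rw [h1]; positivity
  · exact ae_of_all _ fun ξ => by positivity

/-- The sign of `a` is left free because `lintegral_exp_time` applies this with a negative rate. -/
lemma lintegral_exp_neg_mul {a s t : ℝ} (ha : a ≠ 0) (hst : s ≤ t) :
    ∫⁻ r in Ioc s t, ENNReal.ofReal (Real.exp (-(a * r)))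
      = ENNReal.ofReal ((Real.exp (-(a * s)) - Real.exp (-(a * t))) / a) := by
  rw [← ofReal_integral_eq_lintegral_ofReal
    ((Continuous.integrableOn_Icc (by fun_prop)).mono_set Ioc_subset_Icc_self)
    (ae_of_all _ fun r => (Real.exp_pos _).le)]
  congr 1
  rw [← intervalIntegral.integral_of_le hst]
  have h : ∀ r ∈ uIcc s t, HasDerivAt (fun r => -Real.exp (-(a * r)) / a)
      (Real.exp (-(a * r))) r := by
    intro r _
    have h1 : HasDerivAt (fun r => -(a * r)) (-(a * 1)) r :=
      ((hasDerivAt_id r).const_mul a).neg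
    have h2 := (h1.exp.neg).div_const a
    refine h2.congr_deriv ?_
    rw [mul_one, mul_neg, neg_neg, mul_div_assoc, div_self ha, mul_one]
  rw [intervalIntegral.integral_eq_sub_of_hasDerivAt h
    ((by fun_prop : Continuous fun r => Real.exp (-(a * r))).intervalIntegrable _ _)]
  ring

lemma abs_rpow_neg_eq {H ξ : ℝ} (hξ : ξ ≠ 0) :
    |ξ| ^ (-1 - 2 * H) = |ξ| ^ (1 - 2 * H) / ξ ^ 2 := by
  rw [← sq_abs ξ, ← Real.rpow_natCast, ← Real.rpow_sub (abs_pos.2 hξ)]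
  congr 1; push_cast; ring

/-- `∫ (1 - exp(-lξ²)) |ξ|^{-1-2H} dξ = l^H Γ(1-H) / H`. -/
lemma lintegral_one_sub_exp {H l : ℝ} (hH0 : 0 < H) (hH1 : H < 1) (hl : 0 ≤ l) :
    ∫⁻ ξ : ℝ, ENNReal.ofReal ((1 - Real.exp (-(l * ξ ^ 2))) * |ξ| ^ (-1 - 2 * H))
      = ENNReal.ofReal (l ^ H * (Real.Gamma (1 - H) / H)) := by
  have hG : 0 < Real.Gamma (1 - H) := Real.Gamma_pos_of_pos (by linarith)
  -- Writing `(1 - exp(-lξ²))/ξ²` as the integral of `exp(-rξ²)` over `r ∈ (0,l]` and exchanging the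
  -- integrals leaves a Gaussian moment in `ξ`, equal to `Γ(1-H) r^{H-1}`.
  calc ∫⁻ ξ : ℝ, ENNReal.ofReal ((1 - Real.exp (-(l * ξ ^ 2))) * |ξ| ^ (-1 - 2 * H))
      = ∫⁻ ξ : ℝ, ∫⁻ r in Ioc 0 l, ENNReal.ofReal (|ξ| ^ (1 - 2 * H) * Real.exp (-r * ξ ^ 2)) := by
        refine lintegral_congr_ae ?_
        filter_upwards [Measure.ae_ne volume (0 : ℝ)] with ξ hξ
        simp_rw [ENNReal.ofReal_mul (Real.rpow_nonneg (abs_nonneg ξ) _)]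
        rw [lintegral_const_mul _ (by fun_prop)]
        have h := lintegral_exp_neg_mul (pow_ne_zero 2 hξ) hl
        simp_rw [mul_comm (ξ ^ 2), ← neg_mul] at h
        rw [h, ← ENNReal.ofReal_mul (by positivity), abs_rpow_neg_eq hξ]
        congr 1
        simp only [neg_zero, zero_mul, Real.exp_zero, neg_mul]
        ring
    _ = ∫⁻ r in Ioc 0 l, ENNReal.ofReal (Real.Gamma (1 - H) * r ^ (H - 1)) := by
        rw [lintegral_lintegral_swap (by fun_prop)]
        refine setLIntegral_congr_fun measurableSet_Ioc fun r hr => ?_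
        rw [lintegral_abs_rpow_mul_exp (by linarith) hr.1, mul_comm]
        congr 2
        · congr 1; ring
        · congr 1; ring
    _ = ENNReal.ofReal (l ^ H * (Real.Gamma (1 - H) / H)) := by
        have hi : IntervalIntegrable (fun r : ℝ => r ^ (H - 1)) volume 0 l :=
          intervalIntegral.intervalIntegrable_rpow' (by linarith)
        rw [← ofReal_integral_eq_lintegral_ofReal, ← intervalIntegral.integral_of_le hl,
          intervalIntegral.integral_const_mul, integral_rpow (Or.inl (by linarith))]
        · congr 1
          rw [sub_add_cancel, Real.zero_rpow hH0.ne']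
          ring
        · exact ((intervalIntegrable_iff_integrableOn_Ioc_of_le hl).1 hi).const_mul _
        · filter_upwards [ae_restrict_mem measurableSet_Ioc] with r hr
          have := hr.1
          positivity

lemma lintegral_comp_mul_left_eq {a : ℝ} (ha : a ≠ 0) {f : ℝ → ℝ≥0∞} (hf : Measurable f) :
    ∫⁻ x, f (a * x) = ENNReal.ofReal |a⁻¹| * ∫⁻ x, f x := by
  rw [← lintegral_map hf (measurable_const_mul a), Real.map_volume_mul_left ha,
    lintegral_smul_measure, smul_eq_mul]

/-! ### The cosine integral and the normalising constant `CH` -/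

lemma lintegral_one_sub_cos_scale {H : ℝ} (hH0 : 0 < H) (x : ℝ) :
    ∫⁻ ξ : ℝ, ENNReal.ofReal ((1 - Real.cos (x * ξ)) * |ξ| ^ (-1 - 2 * H))
      = ENNReal.ofReal (|x| ^ (2 * H))
        * ∫⁻ ξ : ℝ, ENNReal.ofReal ((1 - Real.cos ξ) * |ξ| ^ (-1 - 2 * H)) := by
  rcases eq_or_ne x 0 with rfl | hx
  · simp [Real.zero_rpow (by positivity : 2 * H ≠ 0)]
  have hx' : 0 < |x| := abs_pos.2 hx
  have h := lintegral_comp_mul_left_eq hx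
    (f := fun ξ => ENNReal.ofReal ((1 - Real.cos ξ) * |ξ| ^ (-1 - 2 * H))) (by fun_prop)
  have h2 : ∀ ξ : ℝ, ENNReal.ofReal ((1 - Real.cos (x * ξ)) * |x * ξ| ^ (-1 - 2 * H))
      = ENNReal.ofReal (|x| ^ (-1 - 2 * H))
        * ENNReal.ofReal ((1 - Real.cos (x * ξ)) * |ξ| ^ (-1 - 2 * H)) := by
    intro ξ
    rw [← ENNReal.ofReal_mul (by positivity), abs_mul, Real.mul_rpow hx'.le (abs_nonneg ξ)]
    congr 1; ring
  simp_rw [h2] at h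
  rw [lintegral_const_mul _ (by fun_prop)] at h
  have h3 : ENNReal.ofReal (|x| ^ (1 + 2 * H)) * ENNReal.ofReal (|x| ^ (-1 - 2 * H)) = 1 := by
    rw [← ENNReal.ofReal_mul (by positivity), ← Real.rpow_add hx']
    simp
  have h4 : ENNReal.ofReal (|x| ^ (1 + 2 * H)) * ENNReal.ofReal |x⁻¹|
      = ENNReal.ofReal (|x| ^ (2 * H)) := by
    rw [← ENNReal.ofReal_mul (by positivity), abs_inv, ← Real.rpow_neg_one, ← Real.rpow_add hx']
    congr 2; ring
  rw [← h4, mul_assoc, ← h, ← mul_assoc, h3, one_mul]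

/-- The real part of the characteristic function of `N(0,2)`. The variance `2` makes it exactly
`exp(-ξ²)`, so that `lintegral_one_sub_exp` applies with `l = 1`. -/
lemma lintegral_one_sub_cos_gaussianReal (ξ : ℝ) :
    ∫⁻ x, ENNReal.ofReal (1 - Real.cos (x * ξ)) ∂(gaussianReal 0 2)
      = ENNReal.ofReal (1 - Real.exp (-(1 * ξ ^ 2))) := by
  have hi : Integrable (fun x : ℝ => Complex.exp (ξ * x * Complex.I)) (gaussianReal 0 2) := by
    refine (integrable_const (1 : ℝ)).mono' (by fun_prop) (ae_of_all _ fun x => ?_)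
    rw [← Complex.ofReal_mul, Complex.norm_exp_ofReal_mul_I]
  have h := charFun_gaussianReal (μ := 0) (v := 2) ξ
  rw [charFun_apply_real] at h
  have h2 := congrArg Complex.re h
  have hre : ∀ x : ℝ, (Complex.exp (ξ * x * Complex.I)).re = Real.cos (x * ξ) := fun x => by
    rw [← Complex.ofReal_mul, Complex.exp_ofReal_mul_I_re, mul_comm]
  rw [← RCLike.re_eq_complex_re, ← integral_re hi] at h2
  simp only [RCLike.re_eq_complex_re, hre] at h2
  have h3 : (Complex.exp (ξ * (0 : ℝ) * Complex.I - ((2 : ℝ≥0) : ℝ) * (ξ : ℂ) ^ 2 / 2)).re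
      = Real.exp (-(1 * ξ ^ 2)) := by
    rw [← Complex.exp_ofReal_re]
    congr 2
    push_cast
    ring
  rw [h3] at h2
  have hc : Integrable (fun x : ℝ => Real.cos (x * ξ)) (gaussianReal 0 2) := by
    refine (integrable_const (1 : ℝ)).mono' (by fun_prop) (ae_of_all _ fun x => ?_)
    exact Real.abs_cos_le_one _
  have hsub : Integrable (fun x : ℝ => 1 - Real.cos (x * ξ)) (gaussianReal 0 2) :=
    (integrable_const _).sub hc
  rw [← ofReal_integral_eq_lintegral_ofReal hsub
    (ae_of_all _ fun x => sub_nonneg.2 (Real.cos_le_one _)),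
    integral_sub (integrable_const _) hc, h2]
  simp

lemma lintegral_abs_rpow_gaussianReal {q : ℝ} (hq : -1 < q) :
    ∫⁻ x, ENNReal.ofReal (|x| ^ q) ∂(gaussianReal 0 2)
      = ENNReal.ofReal (2 ^ q * Real.Gamma ((q + 1) / 2) / √Real.pi) := by
  rw [gaussianReal_of_var_ne_zero _ two_ne_zero,
    lintegral_withDensity_eq_lintegral_mul _ (by fun_prop) (by fun_prop)]
  have h1 : ∀ x : ℝ, (gaussianPDF 0 2 * fun x => ENNReal.ofReal (|x| ^ q)) x
      = ENNReal.ofReal ((√(2 * Real.pi * 2))⁻¹) *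
        ENNReal.ofReal (|x| ^ q * Real.exp (-(1 / 4) * x ^ 2)) := by
    intro x
    rw [Pi.mul_apply, gaussianPDF, gaussianPDFReal, ← ENNReal.ofReal_mul (by positivity),
      ← ENNReal.ofReal_mul (by positivity)]
    congr 1
    rw [mul_assoc, mul_comm (|x| ^ q)]
    congr 3
    push_cast
    ring
  simp_rw [h1]
  rw [lintegral_const_mul _ (by fun_prop), lintegral_abs_rpow_mul_exp hq (by norm_num),
    ← ENNReal.ofReal_mul (by positivity)]
  congr 1
  have e1 : ((1 : ℝ) / 4) ^ (-(q + 1) / 2) = 2 * 2 ^ q := by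
    rw [show ((1 : ℝ) / 4) = 2 ^ (-2 : ℝ) by norm_num [Real.rpow_neg], ← Real.rpow_mul zero_le_two,
      show (-2 : ℝ) * (-(q + 1) / 2) = 1 + q by ring, Real.rpow_add zero_lt_two, Real.rpow_one]
  have e2 : √(2 * Real.pi * 2) = 2 * √Real.pi := by
    rw [show 2 * Real.pi * 2 = 2 ^ 2 * Real.pi by ring, Real.sqrt_mul (by positivity),
      Real.sqrt_sq zero_le_two]
  rw [e1, e2]
  field_simp

lemma CH_pos {H : ℝ} (hH0 : 0 < H) (hH1 : H < 1) : 0 < CH H := by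
  have h1 : 0 < Real.Gamma (2 * H + 1) := Real.Gamma_pos_of_pos (by linarith)
  have h2 : 0 < Real.sin (Real.pi * H) :=
    Real.sin_pos_of_pos_of_lt_pi (by positivity) (by nlinarith [Real.pi_pos])
  unfold CH
  positivity

/-- Legendre's duplication formula combined with Euler's reflection formula. The right side is the
absolute moment of order `2H` of `N(0,2)`, which is where `CH` meets the Gaussian average below. -/
lemma CH_mul_Gamma {H : ℝ} (hH0 : 0 < H) (hH1 : H < 1) :
    2 * CH H * (Real.Gamma (1 - H) / H)
      = 2 ^ (2 * H) * Real.Gamma (H + 1 / 2) / √Real.pi := by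
  have h2 : 0 < Real.sin (Real.pi * H) :=
    Real.sin_pos_of_pos_of_lt_pi (by positivity) (by nlinarith [Real.pi_pos])
  have hG := Real.Gamma_pos_of_pos hH0
  have hd := Real.Gamma_mul_Gamma_add_half H
  have hr := Real.Gamma_mul_Gamma_one_sub H
  have h3 : Real.Gamma (2 * H + 1) = 2 * H * Real.Gamma (2 * H) :=
    Real.Gamma_add_one (by positivity)
  have hp : (2 : ℝ) ^ (2 * H) * 2 ^ (1 - 2 * H) = 2 := by
    rw [← Real.rpow_add zero_lt_two]; simp
  have hs := Real.sq_sqrt Real.pi_pos.le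
  have hs0 : 0 < √Real.pi := Real.sqrt_pos.2 Real.pi_pos
  rw [eq_div_iff h2.ne', mul_comm Real.pi] at hr
  unfold CH
  rw [h3]
  have hGne := hG.ne'
  refine mul_left_cancel₀ hGne ?_
  have e1 : Real.Gamma H * (2 ^ (2 * H) * Real.Gamma (H + 1 / 2) / √Real.pi)
      = 2 * Real.Gamma (2 * H) := by
    calc _ = 2 ^ (2 * H) * (Real.Gamma H * Real.Gamma (H + 1 / 2)) / √Real.pi := by ring
      _ = (2 ^ (2 * H) * 2 ^ (1 - 2 * H)) * Real.Gamma (2 * H) := by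
        rw [hd]; field_simp
      _ = _ := by rw [hp]
  rw [e1]
  field_simp
  linear_combination hr

/-- `∫ (1 - cos(xξ)) |ξ|^{-1-2H} dξ = |x|^{2H} / (2 C_H)`. -/
lemma lintegral_one_sub_cos {H : ℝ} (hH0 : 0 < H) (hH1 : H < 1) (x : ℝ) :
    ∫⁻ ξ : ℝ, ENNReal.ofReal ((1 - Real.cos (x * ξ)) * |ξ| ^ (-1 - 2 * H))
      = ENNReal.ofReal (|x| ^ (2 * H) / (2 * CH H)) := by
  set S := ∫⁻ ξ : ℝ, ENNReal.ofReal ((1 - Real.cos ξ) * |ξ| ^ (-1 - 2 * H)) with hS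
  have hC := CH_pos hH0 hH1
  have hG : 0 < Real.Gamma (1 - H) := Real.Gamma_pos_of_pos (by linarith)
  -- By scaling only the constant `S` is unknown. Averaging over `x ∼ N(0,2)` is done in two ways:
  -- scaling gives a known moment times `S`, while integrating in `x` first gives `Γ(1-H)/H`.
  -- Comparing them yields `2 CH S = 1`.
  have h1 : ∫⁻ x, ∫⁻ ξ : ℝ, ENNReal.ofReal ((1 - Real.cos (x * ξ)) * |ξ| ^ (-1 - 2 * H))
      ∂volume ∂(gaussianReal 0 2)
      = ENNReal.ofReal (2 * CH H * (Real.Gamma (1 - H) / H)) * S := by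
    simp_rw [lintegral_one_sub_cos_scale hH0]
    rw [lintegral_mul_const _ (by fun_prop), lintegral_abs_rpow_gaussianReal (by linarith),
      CH_mul_Gamma hH0 hH1, show (2 * H + 1) / 2 = H + 1 / 2 by ring]
  rw [lintegral_lintegral_swap (by fun_prop)] at h1
  have h2 : ∀ ξ : ℝ, ∫⁻ x, ENNReal.ofReal ((1 - Real.cos (x * ξ)) * |ξ| ^ (-1 - 2 * H))
      ∂(gaussianReal 0 2)
      = ENNReal.ofReal ((1 - Real.exp (-(1 * ξ ^ 2))) * |ξ| ^ (-1 - 2 * H)) := by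
    intro ξ
    simp_rw [fun x => ENNReal.ofReal_mul (q := |ξ| ^ (-1 - 2 * H))
      (sub_nonneg.2 (Real.cos_le_one (x * ξ)))]
    rw [lintegral_mul_const _ (by fun_prop), lintegral_one_sub_cos_gaussianReal,
      ENNReal.ofReal_mul]
    simp only [sub_nonneg, Real.exp_le_one_iff]
    nlinarith [sq_nonneg ξ]
  simp_rw [h2] at h1
  rw [lintegral_one_sub_exp hH0 hH1 zero_le_one, Real.one_rpow, one_mul,
    mul_comm (2 * CH H), ENNReal.ofReal_mul (by positivity), mul_assoc] at h1
  have h3 : ENNReal.ofReal (2 * CH H) * S = 1 := by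
    have hne : ENNReal.ofReal (Real.Gamma (1 - H) / H) ≠ 0 := by
      rw [Ne, ENNReal.ofReal_eq_zero, not_le]; positivity
    rw [← ENNReal.mul_right_inj hne ENNReal.ofReal_ne_top, ← h1, mul_one]
  rw [lintegral_one_sub_cos_scale hH0, ← hS, div_eq_mul_inv, ENNReal.ofReal_mul (by positivity),
    ENNReal.ofReal_inv_of_pos (by positivity)]
  congr 1
  exact ENNReal.eq_inv_of_mul_eq_one_left (by rwa [mul_comm])

/-! ### Comparison of the constants -/

lemma integrable_integral_one_sub_exp {H l : ℝ} (hH0 : 0 < H) (hH1 : H < 1) (hl : 0 < l) :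
    Integrable (fun ξ : ℝ => (1 - Real.exp (-(l * ξ ^ 2))) * |ξ| ^ (-1 - 2 * H)) ∧
    ∫ ξ : ℝ, (1 - Real.exp (-(l * ξ ^ 2))) * |ξ| ^ (-1 - 2 * H)
      = l ^ H * (Real.Gamma (1 - H) / H) := by
  have hG : 0 < Real.Gamma (1 - H) := Real.Gamma_pos_of_pos (by linarith)
  have h0 : ∀ ξ : ℝ, 0 ≤ (1 - Real.exp (-(l * ξ ^ 2))) * |ξ| ^ (-1 - 2 * H) := fun ξ => by
    refine mul_nonneg ?_ (by positivity)
    rw [sub_nonneg, Real.exp_le_one_iff]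
    nlinarith [mul_nonneg hl.le (sq_nonneg ξ)]
  have h1 : ∫ ξ : ℝ, (1 - Real.exp (-(l * ξ ^ 2))) * |ξ| ^ (-1 - 2 * H)
      = l ^ H * (Real.Gamma (1 - H) / H) := by
    rw [integral_eq_lintegral_of_nonneg_ae (ae_of_all _ h0) (by fun_prop),
      lintegral_one_sub_exp hH0 hH1 hl.le, ENNReal.toReal_ofReal (by positivity)]
  refine ⟨Integrable.of_integral_ne_zero ?_, h1⟩
  rw [h1]
  positivity

/-- Expanding the square as `2(1 - exp(-u²)) - (1 - exp(-2u²))` reduces the integral to the closed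
form at `l = 1` and `l = 2`. -/
lemma c2H_eq {H : ℝ} (hH0 : 0 < H) (hH1 : H < 1) :
    c2H H = (1 - 2 ^ (H - 1)) * (Real.Gamma (1 - H) / H) := by
  obtain ⟨i1, e1⟩ := integrable_integral_one_sub_exp hH0 hH1 zero_lt_one
  obtain ⟨i2, e2⟩ := integrable_integral_one_sub_exp hH0 hH1 zero_lt_two
  have h : ∀ u : ℝ, (1 - Real.exp (-u ^ 2)) ^ 2 / |u| ^ (1 + 2 * H)
      = 2 * ((1 - Real.exp (-(1 * u ^ 2))) * |u| ^ (-1 - 2 * H))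
        - (1 - Real.exp (-(2 * u ^ 2))) * |u| ^ (-1 - 2 * H) := by
    intro u
    rw [show -1 - 2 * H = -(1 + 2 * H) by ring, Real.rpow_neg (abs_nonneg u),
      show -(2 * u ^ 2) = -u ^ 2 + -u ^ 2 by ring, Real.exp_add, one_mul, div_eq_mul_inv]
    ring
  unfold c2H
  simp_rw [h]
  rw [integral_sub (i1.const_mul 2) i2, integral_const_mul, e1, e2, Real.one_rpow,
    Real.rpow_sub zero_lt_two, Real.rpow_one]
  ring

/-- Convexity of `Γ` between `1/2` and `1`, where its values are `√π` and `1`. -/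
lemma Gamma_one_sub_le {H : ℝ} (hH0 : 0 < H) (hH : H ≤ 1 / 2) :
    Real.Gamma (1 - H) ≤ √Real.pi := by
  have h := Real.convexOn_Gamma.2 (mem_Ioi.2 (by norm_num : (0 : ℝ) < 1 / 2))
    (mem_Ioi.2 one_pos) (by linarith : 0 ≤ 2 * H) (by linarith : 0 ≤ 1 - 2 * H) (by ring)
  have hpi : 1 ≤ √Real.pi := Real.one_le_sqrt.2 (by linarith [Real.pi_gt_three])
  simp only [smul_eq_mul, Real.Gamma_one_half_eq, Real.Gamma_one] at h
  rw [show 2 * H * (1 / 2) + (1 - 2 * H) * 1 = 1 - H by ring] at h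
  nlinarith

/-- By reflection the product equals `πH / sin(πH)`, and `sin r ≤ r`. -/
lemma one_le_Gamma_mul_Gamma {H : ℝ} (hH0 : 0 < H) (hH1 : H < 1) :
    1 ≤ Real.Gamma (H + 1) * Real.Gamma (1 - H) := by
  have h2 : 0 < Real.sin (Real.pi * H) :=
    Real.sin_pos_of_pos_of_lt_pi (by positivity) (by nlinarith [Real.pi_pos])
  rw [Real.Gamma_add_one hH0.ne', mul_assoc, Real.Gamma_mul_Gamma_one_sub, ← mul_div_assoc,
    one_le_div h2, mul_comm]
  exact Real.sin_le (by positivity)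

/-- The left side is what the time increment really costs. The factor `3` is used essentially: `c1H
+ c2H` alone is too small, since it contains `Γ(H+1)` where the computation produces a multiple of
`Γ(1-H)`. -/
lemma Gamma_div_le {H : ℝ} (hH0 : 0 < H) (hH : H ≤ 1 / 2) :
    Real.Gamma (1 - H) / H ≤ 3 * max (c1H H + c2H H) (c3H H) := by
  refine le_trans ?_ (mul_le_mul_of_nonneg_left (le_max_left _ _) zero_le_three)
  rw [c2H_eq hH0 (by linarith), c1H, Real.rpow_neg zero_le_two, Real.rpow_add zero_lt_two,
    Real.rpow_sub zero_lt_two, Real.rpow_one]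
  set g := Real.Gamma (1 - H)
  set p := Real.Gamma (H + 1)
  set a : ℝ := 2 ^ H with ha
  have hg : 0 < g := Real.Gamma_pos_of_pos (by linarith)
  have hp : 0 < p := Real.Gamma_pos_of_pos (by linarith)
  have hgpi := Gamma_one_sub_le hH0 hH
  have hpg : 1 ≤ p * g := one_le_Gamma_mul_Gamma hH0 (by linarith)
  have ha1 : 1 ≤ a := Real.one_le_rpow one_le_two hH0.le
  have ha2 : a ≤ √2 := by
    rw [ha, Real.sqrt_eq_rpow]
    exact Real.rpow_le_rpow_of_exponent_le one_le_two hH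
  have hs2 : √2 ≤ 1.4143 := by
    rw [Real.sqrt_le_left (by norm_num)]; norm_num
  have hg2 : g ^ 2 ≤ 3.15 := by
    calc g ^ 2 ≤ √Real.pi ^ 2 := by gcongr
      _ = Real.pi := Real.sq_sqrt Real.pi_pos.le
      _ ≤ 3.15 := Real.pi_lt_d2.le
  -- After clearing denominators this is the whole claim. On `[1, √2]` the polynomial in `a` stays
  -- below `0.35`, while `g² ≤ 3.15` and `pg ≥ 1` give `0.94 g ≤ 3p`.
  have key : a * (3 * a - 4) * g ≤ 3 * p := by
    have h1 : a * (3 * a - 4) ≤ 1.4143 * 0.2429 := by nlinarith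
    have h2 : 0.94 * g ≤ 3 * p := by
      have : g ^ 2 * 0.94 ≤ 3 * (p * g) := by nlinarith
      nlinarith
    nlinarith
  rw [← sub_nonneg]
  have e : 3 * ((a * 2)⁻¹ * (p / H) + (1 - a / 2) * (g / H)) - g / H
      = (3 * p - a * (3 * a - 4) * g) / (2 * a * H) := by
    field_simp
    ring
  rw [e]
  exact div_nonneg (by linarith) (by positivity)

/-- Reflection at `2H` with `sin(2πH) = 2 sin(πH) cos(πH)`; the endpoint `H = 1/2`, where `Γ(1-2H)`
has its pole, is computed directly. It gives `3 CH c3H = 3/4`, enough to absorb the spatial constant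
`1/2`. -/
lemma CH_mul_c3H {H : ℝ} (hH0 : 0 < H) (hH : H ≤ 1 / 2) : 4 * CH H * c3H H = 1 := by
  unfold CH c3H
  split_ifs with h
  · have hs : 0 < Real.sin (Real.pi * H) :=
      Real.sin_pos_of_pos_of_lt_pi (by positivity) (by nlinarith [Real.pi_pos])
    have hc : 0 < Real.cos (Real.pi * H) :=
      Real.cos_pos_of_mem_Ioo ⟨by nlinarith [Real.pi_pos], by nlinarith [Real.pi_pos]⟩
    have hr := Real.Gamma_mul_Gamma_one_sub (2 * H)
    rw [show Real.pi * (2 * H) = 2 * (Real.pi * H) by ring, Real.sin_two_mul,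
      eq_div_iff (by positivity), mul_comm Real.pi] at hr
    rw [Real.Gamma_add_one (by positivity), mul_comm H Real.pi]
    field_simp
    linear_combination 2 * hr
  · have hH' : H = 1 / 2 := le_antisymm hH (not_lt.1 h)
    subst hH'
    have h1 : Real.Gamma (2 * (1 / 2) + 1) = 1 := by norm_num
    rw [h1, show Real.pi * (1 / 2) = Real.pi / 2 by ring, Real.sin_pi_div_two]
    field_simp
    norm_num

/-! ### Gram matrices and `L²` norms -/

lemma integrable_real_inner {α E : Type*} [MeasurableSpace α] [NormedAddCommGroup E]
    [InnerProductSpace ℝ E] {μ : Measure α} {f g : α → E} (hf : MemLp f 2 μ) (hg : MemLp g 2 μ) :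
    Integrable (fun a => inner ℝ (f a) (g a)) μ := by
  refine (hf.norm.integrable_mul hg.norm).mono (hf.1.inner hg.1) (ae_of_all _ fun a => ?_)
  simpa using abs_real_inner_le_norm (f a) (g a)

/-- The norm of a linear combination depends only on the Gram matrix, so families in two different
`L²` spaces with equal Gram matrices span isometrically. It is used both for increments of `W` and
for Fourier transforms of rectangles. -/
lemma eLpNorm_sum_smul_sq {α E ι : Type*} [MeasurableSpace α] [NormedAddCommGroup E]
    [InnerProductSpace ℝ E] {μ : Measure α} (s : Finset ι) (c : ι → ℝ) {X : ι → α → E}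
    (hX : ∀ i, MemLp (X i) 2 μ) :
    eLpNorm (fun a => ∑ i ∈ s, c i • X i a) 2 μ ^ 2
      = ENNReal.ofReal (∑ i ∈ s, ∑ j ∈ s, c i * (c j * ∫ a, inner ℝ (X i a) (X j a) ∂μ)) := by
  have hi : ∀ i j, Integrable (fun a => c i * (c j * inner ℝ (X i a) (X j a))) μ := fun i j =>
    ((integrable_real_inner (hX i) (hX j)).const_mul _).const_mul _
  have h : ∀ a, ‖∑ i ∈ s, c i • X i a‖ₑ ^ 2
      = ENNReal.ofReal (∑ i ∈ s, ∑ j ∈ s, c i * (c j * inner ℝ (X i a) (X j a))) := by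
    intro a
    rw [← ofReal_norm, ← ENNReal.ofReal_pow (norm_nonneg _), ← real_inner_self_eq_norm_sq,
      sum_inner]
    simp_rw [inner_sum, inner_smul_left, inner_smul_right]
    rfl
  rw [sq_eLpNorm_two]
  simp_rw [h]
  rw [← ofReal_integral_eq_lintegral_ofReal]
  · congr 1
    rw [integral_finsetSum _ fun i _ => integrable_finsetSum _ fun j _ => hi i j]
    refine Finset.sum_congr rfl fun i _ => ?_
    rw [integral_finsetSum _ fun j _ => hi i j]
    refine Finset.sum_congr rfl fun j _ => ?_
    rw [integral_const_mul, integral_const_mul]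
  · exact integrable_finsetSum _ fun i _ => integrable_finsetSum _ fun j _ => hi i j
  · refine ae_of_all _ fun a => ?_
    have : ∑ i ∈ s, ∑ j ∈ s, c i * (c j * inner ℝ (X i a) (X j a))
        = inner ℝ (∑ i ∈ s, c i • X i a) (∑ i ∈ s, c i • X i a) := by
      rw [sum_inner]
      simp_rw [inner_sum, inner_smul_left, inner_smul_right]
      rfl
    simp only [Pi.zero_apply, this]
    exact real_inner_self_nonneg

lemma integral_add_sub_sub {α : Type*} [MeasurableSpace α] {μ : Measure α} {f g h k : α → ℝ}
    (hf : Integrable f μ) (hg : Integrable g μ) (hh : Integrable h μ) (hk : Integrable k μ) :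
    ∫ a, (f a + g a - h a - k a) ∂μ
      = ∫ a, f a ∂μ + ∫ a, g a ∂μ - ∫ a, h a ∂μ - ∫ a, k a ∂μ := by
  have e1 : Integrable (fun a => f a + g a) μ := hf.add hg
  have e2 : Integrable (fun a => f a + g a - h a) μ := e1.sub hh
  rw [integral_sub e2 hk, integral_sub e1 hh, integral_add hf hg]

/-! ### The space of integrands -/

lemma measurable_fourierT {φ : ℝ → ℝ → ℝ} (hφ : Measurable (Function.uncurry φ)) :
    Measurable (fun q : ℝ × ℝ => fourierT (φ q.1) q.2) := by
  have h : Measurable fun q : (ℝ × ℝ) × ℝ =>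
      Complex.exp (-(Complex.I * q.1.2 * q.2)) * φ q.1.1 q.2 := by
    have h2 : Measurable fun q : (ℝ × ℝ) × ℝ => φ q.1.1 q.2 :=
      hφ.comp (f := fun q : (ℝ × ℝ) × ℝ => (q.1.1, q.2)) (by fun_prop)
    fun_prop
  exact h.stronglyMeasurable.integral_prod_right'.measurable

lemma integrable_exp_mul {f : ℝ → ℝ} (hf : Integrable f) (ξ : ℝ) :
    Integrable (fun y : ℝ => Complex.exp (-(Complex.I * ξ * y)) * f y) := by
  have h : Integrable fun y => (f y : ℂ) := hf.ofReal
  refine h.mono ((by fun_prop : Continuous fun y : ℝ =>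
    Complex.exp (-(Complex.I * ξ * y))).aestronglyMeasurable.mul h.1)
    (ae_of_all _ fun y => ?_)
  rw [norm_mul, show -(Complex.I * ξ * y) = ((-(ξ * y) : ℝ) : ℂ) * Complex.I by push_cast; ring,
    Complex.norm_exp_ofReal_mul_I, one_mul]

lemma fourierT_sub {f g : ℝ → ℝ} (hf : Integrable f) (hg : Integrable g) (ξ : ℝ) :
    fourierT (f - g) ξ = fourierT f ξ - fourierT g ξ := by
  unfold fourierT
  rw [← integral_sub (integrable_exp_mul hf ξ) (integrable_exp_mul hg ξ)]
  congr 1 with y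
  simp [mul_sub]

lemma fourierT_sum {ι : Type*} (s : Finset ι) (c : ι → ℝ) {f : ι → ℝ → ℝ}
    (hf : ∀ i, Integrable (f i)) (ξ : ℝ) :
    fourierT (fun y => ∑ i ∈ s, c i * f i y) ξ = ∑ i ∈ s, c i • fourierT (f i) ξ := by
  unfold fourierT
  simp_rw [← integral_smul]
  have h : ∀ i, Integrable fun y : ℝ => c i • (Complex.exp (-(Complex.I * ξ * y)) * f i y) :=
    fun i => (integrable_exp_mul (hf i) ξ).smul (c i)
  rw [← integral_finsetSum _ fun i _ => h i]
  congr 1 with y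
  push_cast
  rw [Finset.mul_sum]
  refine Finset.sum_congr rfl fun i _ => ?_
  rw [Complex.real_smul]
  ring

lemma norm_fourierT_le (f : ℝ → ℝ) (ξ : ℝ) : ‖fourierT f ξ‖ ≤ ∫ y, |f y| := by
  refine (norm_integral_le_integral_norm _).trans_eq ?_
  congr 1 with y
  rw [norm_mul, show -(Complex.I * ξ * y) = ((-(ξ * y) : ℝ) : ℂ) * Complex.I by push_cast; ring,
    Complex.norm_exp_ofReal_mul_I, one_mul, Complex.norm_real, Real.norm_eq_abs]

/-- The measure `dθ ⊗ μ(dξ)` on `[0,T] × ℝ`. -/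
def phaseMeasure (H T : ℝ) : Measure (ℝ × ℝ) :=
  (volume.restrict (Icc 0 T)).prod (spectralMeasure H)

instance (H : ℝ) : SFinite (spectralMeasure H) := by
  unfold spectralMeasure; infer_instance

lemma integrandNormSq_eq (H T : ℝ) {φ : ℝ → ℝ → ℝ} (hφ : Measurable (Function.uncurry φ)) :
    integrandNormSq H T φ
      = eLpNorm (fun q : ℝ × ℝ => fourierT (φ q.1) q.2) 2 (phaseMeasure H T) ^ 2 := by
  rw [sq_eLpNorm_two, phaseMeasure, integrandNormSq, lintegral_prod]
  exact ((measurable_fourierT hφ).enorm.pow_const 2).aemeasurable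

lemma ae_mem_phaseMeasure (H T : ℝ) : ∀ᵐ q ∂(phaseMeasure H T), q.1 ∈ Icc 0 T := by
  have h : ∀ᵐ θ ∂(volume.restrict (Icc 0 T)), θ ∈ Icc (0 : ℝ) T :=
    ae_restrict_mem measurableSet_Icc
  exact Measure.quasiMeasurePreserving_fst.ae h

lemma lintegral_spectralMeasure (H : ℝ) {f : ℝ → ℝ≥0∞} (hf : Measurable f) :
    ∫⁻ ξ, f ξ ∂(spectralMeasure H)
      = ∫⁻ ξ, ENNReal.ofReal (CH H * |ξ| ^ (1 - 2 * H)) * f ξ := by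
  rw [spectralMeasure, lintegral_withDensity_eq_lintegral_mul _ (by fun_prop) hf]
  rfl

/-! ### Fourier transforms of rectangles -/

/-- The indicator function of `(a,b]`. -/
def ioc (a b y : ℝ) : ℝ := (Ioc a b).indicator 1 y

lemma integrable_ioc (a b : ℝ) : Integrable (ioc a b) := by
  change Integrable ((Ioc a b).indicator 1)
  rw [integrable_indicator_iff measurableSet_Ioc]
  exact integrableOn_const (by simp)

lemma measurable_ioc (a b : ℝ) : Measurable (ioc a b) :=
  measurable_one.indicator measurableSet_Ioc

lemma Rect.ind_eq {T : ℝ} (R : Rect T) (θ η : ℝ) : R.ind θ η = ioc R.s R.t θ * ioc R.a R.b η := by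
  unfold Rect.ind ioc
  by_cases h1 : θ ∈ Ioc R.s R.t <;> by_cases h2 : η ∈ Ioc R.a R.b <;>
    simp only [Set.indicator, mem_prod, h1, h2, and_self, and_true, if_true, if_false,
      Pi.one_apply, mul_one, mul_zero, and_false]

lemma fourierT_const_mul (c : ℝ) (f : ℝ → ℝ) (ξ : ℝ) :
    fourierT (fun y => c * f y) ξ = c * fourierT f ξ := by
  unfold fourierT
  rw [← integral_const_mul]
  congr 1 with y
  push_cast; ring

lemma Rect.fourierT_ind {T : ℝ} (R : Rect T) (θ ξ : ℝ) :
    fourierT (R.ind θ) ξ = ioc R.s R.t θ * fourierT (ioc R.a R.b) ξ := by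
  rw [← fourierT_const_mul]
  congr 1 with y
  exact R.ind_eq θ y

lemma Rect.measurable_ind {T : ℝ} (R : Rect T) : Measurable (Function.uncurry R.ind) := by
  have : Function.uncurry R.ind = fun q : ℝ × ℝ => ioc R.s R.t q.1 * ioc R.a R.b q.2 := by
    ext q
    exact R.ind_eq q.1 q.2
  rw [this]
  exact ((measurable_ioc _ _).comp measurable_fst).mul ((measurable_ioc _ _).comp measurable_snd)

lemma Rect.integrable_ind {T : ℝ} (R : Rect T) (θ : ℝ) : Integrable (R.ind θ) := by
  have : R.ind θ = fun y => ioc R.s R.t θ * ioc R.a R.b y := by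
    ext y
    exact R.ind_eq θ y
  rw [this]
  exact (integrable_ioc _ _).const_mul _

lemma fourierT_ioc_eq_exp {a b ξ : ℝ} (hab : a ≤ b) (hξ : ξ ≠ 0) :
    fourierT (ioc a b) ξ
      = (Complex.exp (((-(ξ * b) : ℝ) : ℂ) * Complex.I)
          - Complex.exp (((-(ξ * a) : ℝ) : ℂ) * Complex.I)) / (-(Complex.I * ξ)) := by
  have hc : -(Complex.I * ξ) ≠ 0 := by simp [hξ]
  have h := integral_exp_mul_complex (a := a) (b := b) hc
  rw [intervalIntegral.integral_of_le hab, ← integral_indicator measurableSet_Ioc] at h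
  unfold fourierT
  convert! h using 1
  · congr 1 with y
    by_cases hy : y ∈ Ioc a b <;> simp [ioc, hy]
  · congr 3 <;> push_cast <;> ring

lemma norm_fourierT_ioc_le {a b ξ : ℝ} (hab : a ≤ b) (hξ : ξ ≠ 0) :
    ‖fourierT (ioc a b) ξ‖ ≤ 2 / |ξ| := by
  rw [fourierT_ioc_eq_exp hab hξ, norm_div, norm_neg, norm_mul, Complex.norm_I, one_mul,
    Complex.norm_real, Real.norm_eq_abs]
  gcongr
  refine (norm_sub_le _ _).trans ?_
  rw [Complex.norm_exp_ofReal_mul_I, Complex.norm_exp_ofReal_mul_I]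
  norm_num

lemma fourierT_ioc {a b ξ : ℝ} (hab : a ≤ b) (hξ : ξ ≠ 0) :
    fourierT (ioc a b) ξ
      = ⟨(Real.sin (ξ * b) - Real.sin (ξ * a)) / ξ, (Real.cos (ξ * b) - Real.cos (ξ * a)) / ξ⟩ := by
  have hc : -(Complex.I * ξ) ≠ 0 := by simp [hξ]
  rw [fourierT_ioc_eq_exp hab hξ, div_eq_iff hc]
  apply Complex.ext
  · simp only [Complex.sub_re, Complex.exp_ofReal_mul_I_re, Complex.mul_re, Complex.neg_re,
      Complex.neg_im, Complex.I_re, Complex.I_im, Complex.ofReal_re, Complex.ofReal_im,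
      Complex.mul_im, Real.cos_neg]
    field_simp
    ring
  · simp only [Complex.sub_im, Complex.exp_ofReal_mul_I_im, Complex.mul_im, Complex.neg_re,
      Complex.neg_im, Complex.I_re, Complex.I_im, Complex.ofReal_re, Complex.ofReal_im,
      Complex.mul_re, Real.sin_neg]
    field_simp
    ring

/-- The four ones cancel; they are inserted so that each term is separately integrable against the
singular weight `|ξ|^{-1-2H}`. -/
lemma inner_fourierT_ioc {a b a' b' ξ : ℝ} (hab : a ≤ b) (hab' : a' ≤ b') (hξ : ξ ≠ 0) :
    inner ℝ (fourierT (ioc a b) ξ) (fourierT (ioc a' b') ξ)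
      = ((1 - Real.cos ((b - a') * ξ)) + (1 - Real.cos ((a - b') * ξ))
        - (1 - Real.cos ((b - b') * ξ)) - (1 - Real.cos ((a - a') * ξ))) / ξ ^ 2 := by
  rw [Complex.inner, fourierT_ioc hab hξ, fourierT_ioc hab' hξ]
  simp only [Complex.mul_re, Complex.conj_re, Complex.conj_im]
  have h : ∀ c d : ℝ, Real.cos ((c - d) * ξ)
      = Real.cos (ξ * c) * Real.cos (ξ * d) + Real.sin (ξ * c) * Real.sin (ξ * d) := by
    intro c d
    rw [show (c - d) * ξ = ξ * c - ξ * d by ring, Real.cos_sub]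
  rw [h, h, h, h]
  field_simp
  ring

lemma integrable_integral_one_sub_cos {H : ℝ} (hH0 : 0 < H) (hH1 : H < 1) (x : ℝ) :
    Integrable (fun ξ : ℝ => (1 - Real.cos (x * ξ)) * |ξ| ^ (-1 - 2 * H)) ∧
    ∫ ξ : ℝ, (1 - Real.cos (x * ξ)) * |ξ| ^ (-1 - 2 * H) = |x| ^ (2 * H) / (2 * CH H) := by
  have hC := CH_pos hH0 hH1
  have h0 : ∀ ξ : ℝ, 0 ≤ (1 - Real.cos (x * ξ)) * |ξ| ^ (-1 - 2 * H) := fun ξ =>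
    mul_nonneg (sub_nonneg.2 (Real.cos_le_one _)) (by positivity)
  have hm : Measurable fun ξ : ℝ => (1 - Real.cos (x * ξ)) * |ξ| ^ (-1 - 2 * H) := by fun_prop
  refine ⟨?_, ?_⟩
  -- Integrability is read off the finite lower integral, because the value vanishes at `x = 0` and
  -- nonvanishing cannot be invoked.
  · rw [← lintegral_ofReal_ne_top_iff_integrable hm.aestronglyMeasurable (ae_of_all _ h0),
      lintegral_one_sub_cos hH0 hH1]
    exact ENNReal.ofReal_ne_top
  · rw [integral_eq_lintegral_of_nonneg_ae (ae_of_all _ h0) hm.aestronglyMeasurable,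
      lintegral_one_sub_cos hH0 hH1, ENNReal.toReal_ofReal (by positivity)]

lemma integral_inner_fourierT_ioc {H : ℝ} (hH0 : 0 < H) (hH1 : H < 1) {a b a' b' : ℝ}
    (hab : a ≤ b) (hab' : a' ≤ b') :
    ∫ ξ, inner ℝ (fourierT (ioc a b) ξ) (fourierT (ioc a' b') ξ) ∂(spectralMeasure H)
      = (|b - a'| ^ (2 * H) + |a - b'| ^ (2 * H) - |b - b'| ^ (2 * H) - |a - a'| ^ (2 * H)) / 2 := by
  have hC := CH_pos hH0 hH1
  rw [spectralMeasure, integral_withDensity_eq_integral_toReal_smul (by fun_prop) (by simp)]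
  obtain ⟨i1, e1⟩ := integrable_integral_one_sub_cos hH0 hH1 (b - a')
  obtain ⟨i2, e2⟩ := integrable_integral_one_sub_cos hH0 hH1 (a - b')
  obtain ⟨i3, e3⟩ := integrable_integral_one_sub_cos hH0 hH1 (b - b')
  obtain ⟨i4, e4⟩ := integrable_integral_one_sub_cos hH0 hH1 (a - a')
  have h := integral_const_mul (μ := (volume : Measure ℝ)) (CH H) (fun ξ : ℝ =>
    (1 - Real.cos ((b - a') * ξ)) * |ξ| ^ (-1 - 2 * H)
    + (1 - Real.cos ((a - b') * ξ)) * |ξ| ^ (-1 - 2 * H)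
    - (1 - Real.cos ((b - b') * ξ)) * |ξ| ^ (-1 - 2 * H)
    - (1 - Real.cos ((a - a') * ξ)) * |ξ| ^ (-1 - 2 * H))
  rw [integral_add_sub_sub i1 i2 i3 i4, e1, e2, e3, e4] at h
  refine Eq.trans ?_ (h.trans ?_)
  · refine integral_congr_ae ?_
    filter_upwards [Measure.ae_ne volume (0 : ℝ)] with ξ hξ
    rw [inner_fourierT_ioc hab hab' hξ, ENNReal.toReal_ofReal (by positivity),
      abs_rpow_neg_eq hξ, smul_eq_mul]
    ring
  · field_simp

lemma measurable_fourierT_ioc (a b : ℝ) : Measurable (fourierT (ioc a b)) := by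
  have h1 : Measurable (Function.uncurry fun _ : ℝ => ioc a b) :=
    (measurable_ioc a b).comp measurable_snd
  have h2 : Measurable fun ξ : ℝ => ((0 : ℝ), ξ) := by fun_prop
  have h3 := measurable_fourierT (φ := fun _ => ioc a b) h1
  have h4 := h3.comp h2
  simpa only [Function.comp_def] using h4

lemma memLp_fourierT_ioc {H : ℝ} (hH0 : 0 < H) (hH1 : H < 1) {a b : ℝ} (hab : a ≤ b) :
    MemLp (fourierT (ioc a b)) 2 (spectralMeasure H) := by
  have hC := CH_pos hH0 hH1
  have hm := measurable_fourierT_ioc a b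
  refine ⟨hm.aestronglyMeasurable, ?_⟩
  have h : eLpNorm (fourierT (ioc a b)) 2 (spectralMeasure H) ^ 2
      = ENNReal.ofReal (2 * CH H) * ENNReal.ofReal (|b - a| ^ (2 * H) / (2 * CH H)) := by
    rw [sq_eLpNorm_two, lintegral_spectralMeasure H (hm.enorm.pow_const 2),
      ← lintegral_one_sub_cos hH0 hH1, ← lintegral_const_mul _ (by fun_prop)]
    refine lintegral_congr_ae ?_
    filter_upwards [Measure.ae_ne volume (0 : ℝ)] with ξ hξ
    rw [← ofReal_norm, ← ENNReal.ofReal_pow (norm_nonneg _), ← real_inner_self_eq_norm_sq,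
      inner_fourierT_ioc hab hab hξ, ← ENNReal.ofReal_mul (by positivity),
      ← ENNReal.ofReal_mul (by positivity), abs_rpow_neg_eq hξ,
      show (a - b) * ξ = -((b - a) * ξ) by ring, Real.cos_neg]
    congr 1
    simp only [sub_self, zero_mul, Real.cos_zero]
    ring
  refine (ENNReal.pow_lt_top_iff.1 ?_).resolve_right two_ne_zero
  rw [h]
  exact ENNReal.mul_lt_top ENNReal.ofReal_lt_top ENNReal.ofReal_lt_top

lemma integral_ioc_mul_ioc {T s t s' t' : ℝ} (hs : 0 ≤ s) (hst : s ≤ t) (ht : t ≤ T)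
    (hst' : s' ≤ t') :
    ∫ θ in Icc 0 T, ioc s t θ * ioc s' t' θ
      = min t t' - min t s' - min s t' + min s s' := by
  have h : ∀ θ, ioc s t θ * ioc s' t' θ = (Ioc (max s s') (min t t')).indicator 1 θ := by
    intro θ
    unfold ioc
    rw [← Set.Ioc_inter_Ioc, ← Set.inter_indicator_mul]
    simp
    rfl
  simp_rw [h]
  rw [setIntegral_indicator measurableSet_Ioc, inter_eq_self_of_subset_right]
  · simp only [Pi.one_apply, integral_const, MeasurableSet.univ, measureReal_restrict_apply,
      univ_inter, Real.volume_real_Ioc, smul_eq_mul, mul_one]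
    grind
  · intro θ hθ
    exact ⟨hs.trans ((le_max_left _ _).trans hθ.1.le), hθ.2.trans ((min_le_left _ _).trans ht)⟩

lemma memLp_rect {H : ℝ} (hH0 : 0 < H) (hH1 : H < 1) {T : ℝ} (R : Rect T) :
    MemLp (fun q : ℝ × ℝ => fourierT (R.ind q.1) q.2) 2 (phaseMeasure H T) := by
  refine (memLp_two_iff_integrable_sq_norm
    (measurable_fourierT R.measurable_ind).aestronglyMeasurable).2 ?_
  have h1 := (memLp_two_iff_integrable_sq_norm (memLp_fourierT_ioc hH0 hH1 R.a_le_b).1).1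
    (memLp_fourierT_ioc hH0 hH1 R.a_le_b)
  have h2 : Integrable (ioc R.s R.t) (volume.restrict (Icc 0 T)) := (integrable_ioc _ _).restrict
  refine (h2.mul_prod h1).congr (ae_of_all _ fun q => ?_)
  simp only [R.fourierT_ind]
  by_cases h : q.1 ∈ Ioc R.s R.t <;> simp [ioc, h]

/-- Time and frequency separate under the product measure. The value is kept in exactly the form
that the covariance of increments of `W` takes in `IsFractionalNoise.integral_inner_increment`. -/
lemma integral_inner_rect {H : ℝ} (hH0 : 0 < H) (hH1 : H < 1) {T : ℝ} (R R' : Rect T) :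
    ∫ q : ℝ × ℝ, inner ℝ (fourierT (R.ind q.1) q.2) (fourierT (R'.ind q.1) q.2)
        ∂(phaseMeasure H T)
      = (min R.t R'.t - min R.t R'.s - min R.s R'.t + min R.s R'.s)
        * ((|R.b - R'.a| ^ (2 * H) + |R.a - R'.b| ^ (2 * H) - |R.b - R'.b| ^ (2 * H)
          - |R.a - R'.a| ^ (2 * H)) / 2) := by
  rw [← integral_ioc_mul_ioc R.s_nonneg R.s_le_t R.t_le R'.s_le_t,
    ← integral_inner_fourierT_ioc hH0 hH1 R.a_le_b R'.a_le_b, phaseMeasure, ← integral_prod_mul]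
  congr 1 with q
  rw [R.fourierT_ind, R'.fourierT_ind, ← Complex.real_smul, ← Complex.real_smul,
    real_inner_smul_left, real_inner_smul_right, mul_assoc]

/-! ### The isometry of the elementary integral -/

lemma stepFun_apply (T : ℝ) (f : Rect T →₀ ℝ) (θ η : ℝ) :
    stepFun T f θ η = ∑ R ∈ f.support, f R * R.ind θ η := by
  simp [stepFun, Finsupp.linearCombination_apply, Finsupp.sum, Finset.sum_apply]

lemma stepIntegral_apply {Ω : Type*} (T : ℝ) (W : ℝ → ℝ → Ω → ℝ) (f : Rect T →₀ ℝ) (w : Ω) :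
    stepIntegral T W f w = ∑ R ∈ f.support, f R * R.increment W w := by
  simp [stepIntegral, Finsupp.linearCombination_apply, Finsupp.sum, Finset.sum_apply]

lemma measurable_stepFun (T : ℝ) (f : Rect T →₀ ℝ) : Measurable (Function.uncurry (stepFun T f)) := by
  have : Function.uncurry (stepFun T f)
      = fun q => ∑ R ∈ f.support, f R * Function.uncurry R.ind q := by
    ext q
    exact stepFun_apply T f q.1 q.2
  rw [this]
  exact Finset.measurable_fun_sum _ fun R _ => R.measurable_ind.const_mul _

lemma integrable_stepFun (T : ℝ) (f : Rect T →₀ ℝ) (θ : ℝ) : Integrable (stepFun T f θ) := by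
  have : stepFun T f θ = fun η => ∑ R ∈ f.support, f R * R.ind θ η := by
    ext η
    exact stepFun_apply T f θ η
  rw [this]
  exact integrable_finsetSum _ fun R _ => (R.integrable_ind θ).const_mul _

lemma fourierT_stepFun (T : ℝ) (f : Rect T →₀ ℝ) (θ ξ : ℝ) :
    fourierT (stepFun T f θ) ξ = ∑ R ∈ f.support, f R • fourierT (R.ind θ) ξ := by
  rw [← fourierT_sum _ _ fun R => R.integrable_ind θ]
  congr 1 with η
  exact stepFun_apply T f θ η

section noise

variable {Ω : Type*} [MeasurableSpace Ω] {P : Measure Ω} {H T : ℝ} {W : ℝ → ℝ → Ω → ℝ}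

lemma IsFractionalNoise.memLp (hW : IsFractionalNoise P H T W) {t : ℝ} (ht : t ∈ Icc 0 T) (x : ℝ) :
    MemLp (W t x) 2 P :=
  (hW.gaussian.hasGaussianLaw_eval (⟨t, ht⟩, x)).memLp_two

lemma Rect.s_mem (R : Rect T) : R.s ∈ Icc 0 T := ⟨R.s_nonneg, R.s_le_t.trans R.t_le⟩

lemma Rect.t_mem (R : Rect T) : R.t ∈ Icc 0 T := ⟨R.s_nonneg.trans R.s_le_t, R.t_le⟩

lemma IsFractionalNoise.memLp_increment (hW : IsFractionalNoise P H T W) (R : Rect T) :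
    MemLp (R.increment W) 2 P :=
  (((hW.memLp R.t_mem R.b).sub (hW.memLp R.t_mem R.a)).sub (hW.memLp R.s_mem R.b)).add
    (hW.memLp R.s_mem R.a)

lemma IsFractionalNoise.memLp_stepIntegral (hW : IsFractionalNoise P H T W) (f : Rect T →₀ ℝ) :
    MemLp (stepIntegral T W f) 2 P := by
  have : stepIntegral T W f = fun w => ∑ R ∈ f.support, f R * R.increment W w := by
    ext w
    exact stepIntegral_apply T W f w
  rw [this]
  exact memLp_finsetSum _ fun R _ => (hW.memLp_increment R).const_mul _

lemma IsFractionalNoise.integrable_integral_mul_sub (hW : IsFractionalNoise P H T W) {t s : ℝ}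
    (ht : t ∈ Icc 0 T) (x : ℝ) (hs : s ∈ Icc 0 T) (a b : ℝ) :
    Integrable (fun w => W t x w * (W s b w - W s a w)) P ∧
    ∫ w, W t x w * (W s b w - W s a w) ∂P
      = min t s * ((|b| ^ (2 * H) - |x - b| ^ (2 * H) - |a| ^ (2 * H) + |x - a| ^ (2 * H)) / 2) := by
  have h1 : Integrable (fun w => W t x w * W s b w) P :=
    (hW.memLp ht x).integrable_mul (hW.memLp hs b)
  have h2 : Integrable (fun w => W t x w * W s a w) P :=
    (hW.memLp ht x).integrable_mul (hW.memLp hs a)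
  simp_rw [mul_sub]
  refine ⟨h1.sub h2, ?_⟩
  rw [integral_sub h1 h2, hW.covariance t ht s hs, hW.covariance t ht s hs]
  ring

lemma IsFractionalNoise.integral_inner_increment (hW : IsFractionalNoise P H T W) (R R' : Rect T) :
    ∫ w, inner ℝ (R.increment W w) (R'.increment W w) ∂P
      = (min R.t R'.t - min R.t R'.s - min R.s R'.t + min R.s R'.s)
        * ((|R.b - R'.a| ^ (2 * H) + |R.a - R'.b| ^ (2 * H) - |R.b - R'.b| ^ (2 * H)
          - |R.a - R'.a| ^ (2 * H)) / 2) := by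
  have key : ∀ t ∈ Icc 0 T, ∀ x,
      Integrable (fun w => W t x w * R'.increment W w) P ∧
      ∫ w, W t x w * R'.increment W w ∂P = (min t R'.t - min t R'.s)
        * ((|R'.b| ^ (2 * H) - |x - R'.b| ^ (2 * H) - |R'.a| ^ (2 * H) + |x - R'.a| ^ (2 * H)) / 2)
      := by
    intro t ht x
    obtain ⟨i1, e1⟩ := hW.integrable_integral_mul_sub ht x R'.t_mem R'.a R'.b
    obtain ⟨i2, e2⟩ := hW.integrable_integral_mul_sub ht x R'.s_mem R'.a R'.b
    have h : (fun w => W t x w * R'.increment W w) = fun w =>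
        W t x w * (W R'.t R'.b w - W R'.t R'.a w) - W t x w * (W R'.s R'.b w - W R'.s R'.a w) := by
      ext w
      unfold Rect.increment
      ring
    rw [h]
    refine ⟨i1.sub i2, ?_⟩
    rw [integral_sub i1 i2, e1, e2]
    ring
  obtain ⟨i1, e1⟩ := key R.t R.t_mem R.b
  obtain ⟨i2, e2⟩ := key R.t R.t_mem R.a
  obtain ⟨i3, e3⟩ := key R.s R.s_mem R.b
  obtain ⟨i4, e4⟩ := key R.s R.s_mem R.a
  have h : (fun w => inner ℝ (R.increment W w) (R'.increment W w)) = fun w =>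
      W R.t R.b w * R'.increment W w + W R.s R.a w * R'.increment W w
        - W R.t R.a w * R'.increment W w - W R.s R.b w * R'.increment W w := by
    ext w
    rw [Real.inner_apply, Rect.increment]
    ring
  rw [h, integral_add_sub_sub i1 i4 i2 i3, e1, e2, e3, e4]
  ring

/-- The isometry of the elementary integral. -/
lemma IsFractionalNoise.eLpNorm_stepIntegral_sq (hW : IsFractionalNoise P H T W) (hH0 : 0 < H)
    (hH1 : H < 1) (f : Rect T →₀ ℝ) :
    eLpNorm (stepIntegral T W f) 2 P ^ 2 = integrandNormSq H T (stepFun T f) := by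
  rw [integrandNormSq_eq H T (measurable_stepFun T f)]
  simp_rw [fourierT_stepFun]
  rw [eLpNorm_sum_smul_sq _ _ (memLp_rect hH0 hH1)]
  have h : stepIntegral T W f = fun w => ∑ R ∈ f.support, f R • R.increment W w := by
    ext w
    exact stepIntegral_apply T W f w
  rw [h, eLpNorm_sum_smul_sq _ _ hW.memLp_increment]
  simp_rw [hW.integral_inner_increment, integral_inner_rect hH0 hH1]

end noise

/-! ### The Fourier transform of the heat kernel -/

/-- The Fourier transform `e^{-ixξ} e^{-τξ²}` of `η ↦ G_τ(x-η)`. -/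
def heatFourier (τ x ξ : ℝ) : ℂ :=
  Complex.exp (((-(x * ξ) : ℝ) : ℂ) * Complex.I) * (Real.exp (-(ξ ^ 2 * τ)) : ℝ)

lemma norm_heatFourier (τ x ξ : ℝ) : ‖heatFourier τ x ξ‖ = Real.exp (-(ξ ^ 2 * τ)) := by
  rw [heatFourier, norm_mul, Complex.norm_exp_ofReal_mul_I, one_mul, Complex.norm_real,
    Real.norm_eq_abs, abs_of_pos (Real.exp_pos _)]

lemma fourierT_heatKernel {τ : ℝ} (hτ : 0 < τ) (x ξ : ℝ) :
    fourierT (fun η => heatKernel τ (x - η)) ξ = heatFourier τ x ξ := by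
  have hv : (NNReal.mk (2 * τ) (by positivity)) ≠ 0 := by
    intro h; have := congrArg NNReal.toReal h; simp at this; linarith
  have h1 := charFun_gaussianReal (μ := x) (v := NNReal.mk (2 * τ) (by positivity)) (-ξ)
  rw [charFun_apply_real, integral_gaussianReal_eq_integral_smul hv] at h1
  unfold fourierT
  convert! h1 using 1
  · congr 1 with η
    beta_reduce
    rw [heatKernel_eq_gaussianPDFReal hτ, Complex.real_smul, mul_comm]
    congr 2
    push_cast
    ring
  · rw [heatFourier, Complex.ofReal_exp, ← Complex.exp_add, NNReal.coe_mk]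
    congr 1
    push_cast
    ring

lemma integrable_heatKernel {τ : ℝ} (hτ : 0 < τ) (x : ℝ) :
    Integrable (fun η => heatKernel τ (x - η)) := by
  simp_rw [heatKernel_eq_gaussianPDFReal hτ]
  exact integrable_gaussianPDFReal _ _

lemma convKernel_eq_ite (t x θ : ℝ) :
    convKernel t x θ = if θ ∈ Ico 0 t then (fun η => heatKernel (t - θ) (x - η)) else 0 := by
  ext η
  by_cases h : θ ∈ Ico 0 t
  · simp only [convKernel, indicator_of_mem h, if_pos h]
  · simp only [convKernel, indicator_of_notMem h, if_neg h, Pi.zero_apply]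

lemma integrable_convKernel (t x θ : ℝ) : Integrable (convKernel t x θ) := by
  rw [convKernel_eq_ite]
  split_ifs with h
  · exact integrable_heatKernel (sub_pos.2 h.2) x
  · exact integrable_zero _ _ _

lemma measurable_convKernel (t x : ℝ) : Measurable (Function.uncurry (convKernel t x)) := by
  have h : Function.uncurry (convKernel t x) = (Prod.fst ⁻¹' Ico 0 t).indicator
      (fun q : ℝ × ℝ => heatKernel (t - q.1) (x - q.2)) := by
    ext q
    simp only [Function.uncurry, convKernel, indicator, mem_preimage]
  rw [h]
  refine Measurable.indicator ?_ (measurable_fst measurableSet_Ico)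
  unfold heatKernel
  fun_prop

lemma fourierT_convKernel (t x θ ξ : ℝ) :
    fourierT (convKernel t x θ) ξ = if θ ∈ Ico 0 t then heatFourier (t - θ) x ξ else 0 := by
  rw [convKernel_eq_ite]
  split_ifs with h
  · exact fourierT_heatKernel (sub_pos.2 h.2) x ξ
  · simp [fourierT]

/-! ### Norms of the kernels -/

lemma lintegral_exp_time {a s t : ℝ} (ha : 0 < a) (hst : s ≤ t) :
    ∫⁻ θ in Ico s t, ENNReal.ofReal (Real.exp (-(a * (t - θ))))
      = ENNReal.ofReal ((1 - Real.exp (-(a * (t - s)))) / a) := by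
  have h : ∀ θ, ENNReal.ofReal (Real.exp (-(a * (t - θ))))
      = ENNReal.ofReal (Real.exp (-(a * t))) * ENNReal.ofReal (Real.exp (-(-a * θ))) := by
    intro θ
    rw [← ENNReal.ofReal_mul (Real.exp_pos _).le, ← Real.exp_add]
    congr 2; ring
  simp_rw [h]
  rw [lintegral_const_mul _ (by fun_prop), setLIntegral_congr Ico_ae_eq_Ioc,
    lintegral_exp_neg_mul (neg_ne_zero.2 ha.ne') hst, ← ENNReal.ofReal_mul (Real.exp_pos _).le]
  congr 1
  rw [mul_div_assoc', mul_sub, ← Real.exp_add, ← Real.exp_add, div_neg, ← neg_div]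
  congr 1
  rw [show -(a * t) + -(-a * t) = 0 by ring, Real.exp_zero,
    show -(a * t) + -(-a * s) = -(a * (t - s)) by ring]
  ring

/-- Tonelli: the time integral is taken first at each frequency. The common factor `1/ξ²` left by
integrating exponentials turns `|ξ|^{1-2H}` into `|ξ|^{-1-2H}`. -/
lemma integrandNormSq_le {H T : ℝ} (hH0 : 0 < H) (hH1 : H < 1) {φ : ℝ → ℝ → ℝ}
    (hφ : Measurable (Function.uncurry φ)) {B : ℝ → ℝ}
    (h : ∀ ξ, ξ ≠ 0 → ∫⁻ θ, ‖fourierT (φ θ) ξ‖ₑ ^ 2 ≤ ENNReal.ofReal (B ξ / ξ ^ 2)) :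
    integrandNormSq H T φ
      ≤ ENNReal.ofReal (CH H) * ∫⁻ ξ, ENNReal.ofReal (B ξ * |ξ| ^ (-1 - 2 * H)) := by
  have hC := CH_pos hH0 hH1
  have hm := (measurable_fourierT hφ).enorm.pow_const 2
  rw [integrandNormSq, lintegral_lintegral_swap hm.aemeasurable, lintegral_spectralMeasure,
    ← lintegral_const_mul' _ _ ENNReal.ofReal_ne_top]
  · refine lintegral_mono_ae ?_
    filter_upwards [Measure.ae_ne volume (0 : ℝ)] with ξ hξ
    calc _ ≤ ENNReal.ofReal (CH H * |ξ| ^ (1 - 2 * H)) * ENNReal.ofReal (B ξ / ξ ^ 2) := by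
          gcongr
          exact (setLIntegral_le_lintegral _ _).trans (h ξ hξ)
      _ = _ := by
          rw [← ENNReal.ofReal_mul (by positivity), ← ENNReal.ofReal_mul hC.le,
            abs_rpow_neg_eq hξ]
          congr 1; ring
  · exact hm.lintegral_prod_left'

lemma enorm_sq_heatFourier (τ x ξ : ℝ) :
    ‖heatFourier τ x ξ‖ₑ ^ 2 = ENNReal.ofReal (Real.exp (-(2 * ξ ^ 2 * τ))) := by
  rw [← ofReal_norm, ← ENNReal.ofReal_pow (norm_nonneg _), norm_heatFourier, ← Real.exp_nat_mul]
  congr 2; push_cast; ring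

lemma integrandNormSq_convKernel_le {H T : ℝ} (hH0 : 0 < H) (hH1 : H < 1) {t : ℝ} (ht : 0 < t)
    (x : ℝ) :
    integrandNormSq H T (convKernel t x) ≤ ENNReal.ofReal (CH H * kappaH H * t ^ H) := by
  have hC := CH_pos hH0 hH1
  have h := integrandNormSq_le (T := T) hH0 hH1 (measurable_convKernel t x)
    (B := fun ξ => 1 / 2 * (1 - Real.exp (-(2 * t * ξ ^ 2)))) fun ξ hξ => by
      have hξ2 : 0 < 2 * ξ ^ 2 := by positivity
      refine le_of_eq ?_
      calc ∫⁻ θ, ‖fourierT (convKernel t x θ) ξ‖ₑ ^ 2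
          = ∫⁻ θ in Ico 0 t, ENNReal.ofReal (Real.exp (-(2 * ξ ^ 2 * (t - θ)))) := by
            rw [← lintegral_indicator measurableSet_Ico]
            congr 1 with θ
            rw [fourierT_convKernel, indicator]
            split_ifs
            · exact enorm_sq_heatFourier _ _ _
            · simp
        _ = _ := by
            rw [lintegral_exp_time hξ2 ht.le]
            congr 1
            rw [sub_zero, show 2 * ξ ^ 2 * t = 2 * t * ξ ^ 2 by ring]
            field_simp
  refine h.trans_eq ?_
  simp_rw [mul_assoc (1 / 2 : ℝ), ENNReal.ofReal_mul (by norm_num : (0 : ℝ) ≤ 1 / 2)]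
  rw [lintegral_const_mul _ (by fun_prop), lintegral_one_sub_exp hH0 hH1 (by positivity),
    ← ENNReal.ofReal_mul (by norm_num), ← ENNReal.ofReal_mul hC.le, kappaH,
    Real.mul_rpow zero_le_two ht.le, Real.rpow_sub zero_lt_two, Real.rpow_one]
  congr 1; ring

lemma enorm_sq_heatFourier_sub (τ x y ξ : ℝ) :
    ‖heatFourier τ x ξ - heatFourier τ y ξ‖ₑ ^ 2
      = ENNReal.ofReal (2 * (1 - Real.cos ((x - y) * ξ)))
        * ENNReal.ofReal (Real.exp (-(2 * ξ ^ 2 * τ))) := by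
  rw [← ofReal_norm, ← ENNReal.ofReal_pow (norm_nonneg _),
    ← ENNReal.ofReal_mul (mul_nonneg zero_le_two (sub_nonneg.2 (Real.cos_le_one _)))]
  congr 1
  rw [heatFourier, heatFourier, ← sub_mul, norm_mul, mul_pow, Complex.norm_real,
    Real.norm_eq_abs, sq_abs, ← Real.exp_nat_mul]
  congr 1
  · rw [← Complex.normSq_eq_norm_sq, Complex.normSq_apply]
    simp only [Complex.sub_re, Complex.sub_im, Complex.exp_ofReal_mul_I_re,
      Complex.exp_ofReal_mul_I_im, Real.cos_neg, Real.sin_neg]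
    rw [sub_mul x y ξ, Real.cos_sub]
    nlinarith [Real.sin_sq_add_cos_sq (x * ξ), Real.sin_sq_add_cos_sq (y * ξ)]
  · congr 1; push_cast; ring

lemma integrandNormSq_convKernel_space_le {H T : ℝ} (hH0 : 0 < H) (hH1 : H < 1) {t : ℝ}
    (ht : 0 < t) (x y : ℝ) :
    integrandNormSq H T (convKernel t x - convKernel t y)
      ≤ ENNReal.ofReal (1 / 2 * |x - y| ^ (2 * H)) := by
  have hC := CH_pos hH0 hH1
  have hm : Measurable (Function.uncurry (convKernel t x - convKernel t y)) :=
    (measurable_convKernel t x).sub (measurable_convKernel t y)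
  have h := integrandNormSq_le (T := T) hH0 hH1 hm
    (B := fun ξ => 1 - Real.cos ((x - y) * ξ)) fun ξ hξ => by
      have hξ2 : 0 < 2 * ξ ^ 2 := by positivity
      have hcos : 0 ≤ 1 - Real.cos ((x - y) * ξ) := sub_nonneg.2 (Real.cos_le_one _)
      calc ∫⁻ θ, ‖fourierT ((convKernel t x - convKernel t y) θ) ξ‖ₑ ^ 2
          = ∫⁻ θ in Ico 0 t, ENNReal.ofReal (2 * (1 - Real.cos ((x - y) * ξ)))
              * ENNReal.ofReal (Real.exp (-(2 * ξ ^ 2 * (t - θ)))) := by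
            rw [← lintegral_indicator measurableSet_Ico]
            congr 1 with θ
            rw [Pi.sub_apply, fourierT_sub (integrable_convKernel _ _ _)
              (integrable_convKernel _ _ _), fourierT_convKernel, fourierT_convKernel, indicator]
            split_ifs
            · exact enorm_sq_heatFourier_sub _ _ _ _
            · simp
        _ = ENNReal.ofReal (2 * (1 - Real.cos ((x - y) * ξ))
              * ((1 - Real.exp (-(2 * ξ ^ 2 * (t - 0)))) / (2 * ξ ^ 2))) := by
            rw [lintegral_const_mul _ (by fun_prop), lintegral_exp_time hξ2 ht.le,
              ← ENNReal.ofReal_mul (by positivity)]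
        -- The factor `1 - exp(-2ξ²t)` is bounded by `1`, which makes the estimate uniform in `t`.
        _ ≤ _ := by
            refine ENNReal.ofReal_le_ofReal ?_
            rw [mul_div_assoc', div_le_div_iff₀ hξ2 (by positivity)]
            have := Real.exp_pos (-(2 * ξ ^ 2 * (t - 0)))
            have h3 : 0 ≤ (1 - Real.cos ((x - y) * ξ)) * ξ ^ 2 := by positivity
            nlinarith [mul_nonneg h3 this.le]
  refine h.trans_eq ?_
  rw [lintegral_one_sub_cos hH0 hH1, ← ENNReal.ofReal_mul hC.le]
  congr 1
  field_simp

lemma enorm_sq_heatFourier_sub_time {τ σ x ξ : ℝ} :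
    ‖heatFourier (σ + τ) x ξ - heatFourier τ x ξ‖ₑ ^ 2
      = ENNReal.ofReal ((1 - Real.exp (-(ξ ^ 2 * σ))) ^ 2)
        * ENNReal.ofReal (Real.exp (-(2 * ξ ^ 2 * τ))) := by
  rw [← ofReal_norm, ← ENNReal.ofReal_pow (norm_nonneg _), ← ENNReal.ofReal_mul (sq_nonneg _)]
  congr 1
  rw [heatFourier, heatFourier, ← mul_sub, norm_mul, Complex.norm_exp_ofReal_mul_I, one_mul,
    ← Complex.ofReal_sub, Complex.norm_real, Real.norm_eq_abs, sq_abs,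
    show -(ξ ^ 2 * (σ + τ)) = -(ξ ^ 2 * σ) + -(ξ ^ 2 * τ) by ring, Real.exp_add,
    show -(2 * ξ ^ 2 * τ) = -(ξ ^ 2 * τ) + -(ξ ^ 2 * τ) by ring, Real.exp_add]
  ring

lemma integrandNormSq_convKernel_time_le {H T : ℝ} (hH0 : 0 < H) (hH1 : H < 1) {s t : ℝ}
    (hs : 0 < s) (hst : s ≤ t) (x : ℝ) :
    integrandNormSq H T (convKernel t x - convKernel s x)
      ≤ ENNReal.ofReal (CH H * (Real.Gamma (1 - H) / H) * (t - s) ^ H) := by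
  have hC := CH_pos hH0 hH1
  have hm : Measurable (Function.uncurry (convKernel t x - convKernel s x)) :=
    (measurable_convKernel t x).sub (measurable_convKernel s x)
  have h := integrandNormSq_le (T := T) hH0 hH1 hm
    (B := fun ξ => 1 - Real.exp (-((t - s) * ξ ^ 2))) fun ξ hξ => by
      have hξ2 : 0 < 2 * ξ ^ 2 := by positivity
      set p := Real.exp (-(ξ ^ 2 * (t - s))) with hp
      calc ∫⁻ θ, ‖fourierT ((convKernel t x - convKernel s x) θ) ξ‖ₑ ^ 2
          -- On `[0,s)` both kernels are present and differ by the factor `1 - p`; on `[s,t)` only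
          -- the later one is.
          = (∫⁻ θ in Ico 0 s, ENNReal.ofReal ((1 - p) ^ 2)
              * ENNReal.ofReal (Real.exp (-(2 * ξ ^ 2 * (s - θ)))))
            + ∫⁻ θ in Ico s t, ENNReal.ofReal (Real.exp (-(2 * ξ ^ 2 * (t - θ)))) := by
            rw [← lintegral_indicator measurableSet_Ico, ← lintegral_indicator measurableSet_Ico,
              ← lintegral_add_left (Measurable.indicator (by fun_prop) measurableSet_Ico)]
            congr 1 with θ
            rw [Pi.sub_apply, fourierT_sub (integrable_convKernel _ _ _)
              (integrable_convKernel _ _ _), fourierT_convKernel, fourierT_convKernel]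
            by_cases h1 : θ ∈ Ico 0 s
            · have h2 : θ ∉ Ico s t := fun h => absurd h.1 (not_le.2 h1.2)
              have h3 : θ ∈ Ico 0 t := ⟨h1.1, h1.2.trans_le hst⟩
              rw [if_pos h1, if_pos h3, indicator_of_mem h1, indicator_of_notMem h2, add_zero, hp,
                ← enorm_sq_heatFourier_sub_time (x := x), sub_add_sub_cancel]
            · rw [if_neg h1, sub_zero, indicator_of_notMem h1, zero_add]
              by_cases h2 : θ ∈ Ico s t
              · have h3 : θ ∈ Ico 0 t := ⟨hs.le.trans h2.1, h2.2⟩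
                rw [if_pos h3, indicator_of_mem h2, enorm_sq_heatFourier]
              · have h3 : θ ∉ Ico 0 t := fun h3 => by
                  rcases lt_or_ge θ s with h4 | h4
                  · exact h1 ⟨h3.1, h4⟩
                  · exact h2 ⟨h4, h3.2⟩
                rw [if_neg h3, indicator_of_notMem h2]
                simp
        _ = ENNReal.ofReal ((1 - p) ^ 2 * ((1 - Real.exp (-(2 * ξ ^ 2 * (s - 0)))) / (2 * ξ ^ 2))
              + (1 - p ^ 2) / (2 * ξ ^ 2)) := by
            have h1 : Real.exp (-(2 * ξ ^ 2 * (s - 0))) ≤ 1 := by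
              rw [Real.exp_le_one_iff]; nlinarith
            have h2 : p ^ 2 = Real.exp (-(2 * ξ ^ 2 * (t - s))) := by
              rw [hp, ← Real.exp_nat_mul]; congr 1; push_cast; ring
            have h3 : Real.exp (-(2 * ξ ^ 2 * (t - s))) ≤ 1 := by
              rw [Real.exp_le_one_iff]; nlinarith [sub_nonneg.2 hst]
            rw [lintegral_const_mul _ (by fun_prop), lintegral_exp_time hξ2 hs.le,
              lintegral_exp_time hξ2 hst, ← ENNReal.ofReal_mul (sq_nonneg _), ENNReal.ofReal_add, h2]
            · exact mul_nonneg (sq_nonneg _) (div_nonneg (by linarith) hξ2.le)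
            · exact div_nonneg (by linarith) hξ2.le
        -- Dropping `exp(-2ξ²s)` leaves `(1-p)² + (1-p²) = 2(1-p)` over `2ξ²`.
        _ ≤ _ := by
            refine ENNReal.ofReal_le_ofReal ?_
            rw [show (t - s) * ξ ^ 2 = ξ ^ 2 * (t - s) by ring, ← hp, mul_div_assoc', ← add_div,
              div_le_div_iff₀ hξ2 (by positivity)]
            have := Real.exp_pos (-(2 * ξ ^ 2 * (s - 0)))
            have h3 : 0 ≤ ξ ^ 2 := sq_nonneg ξ
            have h4 : 0 ≤ (1 - p) ^ 2 * Real.exp (-(2 * ξ ^ 2 * (s - 0))) := by positivity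
            nlinarith [mul_nonneg h3 h4]
  refine h.trans_eq ?_
  rw [lintegral_one_sub_exp hH0 hH1 (sub_nonneg.2 hst), ← ENNReal.ofReal_mul hC.le]
  congr 1; ring

/-! ### Approximation of the heat kernel by step functions in space -/

/-- The half-width of the superlevel set `{G_τ(x-·) ≥ (k+1)/n · max G_τ}`. -/
def levelRadius (τ : ℝ) (n k : ℕ) : ℝ := √(4 * τ * Real.log (n / (k + 1)))

/-- The maximum of the heat kernel at time `τ`. -/
def heatMax (τ : ℝ) : ℝ := 1 / √(4 * Real.pi * τ)

/-- The layer-cake approximation of `G_τ(x-·)` by a sum of `n` indicator functions of intervals. -/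
def layerCake (τ x : ℝ) (n : ℕ) (y : ℝ) : ℝ :=
  ∑ k ∈ Finset.range n,
    heatMax τ / n * ioc (x - levelRadius τ n k) (x + levelRadius τ n k) y

lemma heatMax_nonneg (τ : ℝ) : 0 ≤ heatMax τ := by unfold heatMax; positivity

lemma heatKernel_eq (τ x y : ℝ) :
    heatKernel τ (x - y) = heatMax τ * Real.exp (-((x - y) ^ 2 / (4 * τ))) := by
  rw [heatKernel, heatMax, sq_abs, neg_div]

/-- Superlevel sets of the Gaussian are symmetric intervals. The left endpoint is excluded because
the intervals of a step function are half-open while the level set is closed. -/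
lemma mem_level_iff {τ : ℝ} (hτ : 0 < τ) {x y : ℝ} {n k : ℕ} (hk : k < n)
    (hy : y ≠ x - levelRadius τ n k) :
    y ∈ Ioc (x - levelRadius τ n k) (x + levelRadius τ n k)
      ↔ k < ⌊n * Real.exp (-((x - y) ^ 2 / (4 * τ)))⌋₊ := by
  have hn : (0 : ℝ) < n := by exact_mod_cast (Nat.zero_le k).trans_lt hk
  have hk1 : (0 : ℝ) < (k : ℝ) + 1 := by positivity
  have h1 : y ∈ Ioc (x - levelRadius τ n k) (x + levelRadius τ n k)
      ↔ |x - y| ≤ levelRadius τ n k := by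
    rw [abs_le, mem_Ioc]
    constructor
    · rintro ⟨h1, h2⟩
      constructor <;> linarith
    · rintro ⟨h1, h2⟩
      exact ⟨lt_of_le_of_ne (by linarith) hy.symm, by linarith⟩
  have hlog : 0 ≤ Real.log (n / (k + 1)) := by
    refine Real.log_nonneg ((one_le_div hk1).2 ?_)
    exact_mod_cast hk
  rw [h1, levelRadius, Real.le_sqrt (abs_nonneg _) (by positivity), sq_abs,
    ← div_le_iff₀' (by positivity), Real.le_log_iff_exp_le (by positivity), le_div_iff₀ hk1,
    Real.exp_neg, ← Nat.succ_le_iff, Nat.le_floor_iff (by positivity), ← div_eq_mul_inv,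
    le_div_iff₀ (Real.exp_pos _), mul_comm]
  push_cast
  rfl

/-- Counting the layers that contain `y` rounds the normalised kernel down to a multiple of `1/n`.
Hence the error is at most one layer, and also at most the kernel itself. -/
lemma layerCake_ae {τ : ℝ} (hτ : 0 < τ) (x : ℝ) :
    ∀ᵐ y, ∀ n, layerCake τ x n y
      = heatMax τ / n * ⌊n * Real.exp (-((x - y) ^ 2 / (4 * τ)))⌋₊ := by
  have h : ∀ᵐ y, ∀ n k, y ≠ x - levelRadius τ n k :=
    ae_all_iff.2 fun n => ae_all_iff.2 fun k => Measure.ae_ne volume _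
  filter_upwards [h] with y hy n
  set m := ⌊n * Real.exp (-((x - y) ^ 2 / (4 * τ)))⌋₊ with hm
  have hmn : m ≤ n := by
    rw [hm]
    refine Nat.floor_le_of_le (mul_le_of_le_one_right n.cast_nonneg ?_)
    rw [Real.exp_le_one_iff, neg_nonpos]
    positivity
  rw [layerCake, ← Finset.mul_sum]
  congr 1
  have h1 : ∀ k ∈ Finset.range n,
      ioc (x - levelRadius τ n k) (x + levelRadius τ n k) y = if k < m then 1 else 0 := by
    intro k hk
    have h2 := mem_level_iff hτ (Finset.mem_range.1 hk) (hy n k)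
    rw [ioc, indicator]
    simp only [h2, Pi.one_apply, hm]
  rw [Finset.sum_congr rfl h1, Finset.sum_boole]
  congr 1
  have h3 : (Finset.range n).filter (fun k => k < m) = Finset.range m := by
    ext k
    simp only [Finset.mem_filter, Finset.mem_range]
    omega
  rw [h3, Finset.card_range]

lemma layerCake_bounds {τ : ℝ} (hτ : 0 < τ) (x : ℝ) :
    ∀ᵐ y, ∀ n : ℕ, |heatKernel τ (x - y) - layerCake τ x n y| ≤ heatKernel τ (x - y) ∧
      (n ≠ 0 → |heatKernel τ (x - y) - layerCake τ x n y| ≤ heatMax τ / n) := by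
  filter_upwards [layerCake_ae hτ x] with y hy n
  rw [hy, heatKernel_eq]
  set p := Real.exp (-((x - y) ^ 2 / (4 * τ)))
  have hp : 0 < p := Real.exp_pos _
  have hM := heatMax_nonneg τ
  rcases Nat.eq_zero_or_pos n with rfl | hn
  · simp [abs_of_nonneg (mul_nonneg hM hp.le)]
  have hn' : (0 : ℝ) < n := by exact_mod_cast hn
  have h1 : (⌊n * p⌋₊ : ℝ) ≤ n * p := Nat.floor_le (by positivity)
  have h2 : n * p < ⌊n * p⌋₊ + 1 := Nat.lt_floor_add_one _
  have hMn : 0 ≤ heatMax τ / n := by positivity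
  have e : heatMax τ * p = heatMax τ / n * (n * p) := by field_simp
  have h3 : 0 ≤ heatMax τ * p - heatMax τ / n * ⌊n * p⌋₊ := by
    rw [e, ← mul_sub]; exact mul_nonneg hMn (by linarith)
  rw [abs_of_nonneg h3]
  refine ⟨?_, fun _ => ?_⟩
  · have : 0 ≤ heatMax τ / n * (⌊n * p⌋₊ : ℝ) := by positivity
    linarith
  · rw [e, ← mul_sub]
    calc _ ≤ heatMax τ / n * 1 := by gcongr; linarith
      _ = _ := mul_one _

lemma integrable_layerCake (τ x : ℝ) (n : ℕ) : Integrable (layerCake τ x n) :=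
  integrable_finsetSum _ fun _ _ => (integrable_ioc _ _).const_mul _

lemma tendsto_integral_abs_layerCake {τ : ℝ} (hτ : 0 < τ) (x : ℝ) :
    Tendsto (fun n => ∫ y, |heatKernel τ (x - y) - layerCake τ x n y|) atTop (𝓝 0) := by
  have h := tendsto_integral_of_dominated_convergence (μ := (volume : Measure ℝ))
    (F := fun n y => |heatKernel τ (x - y) - layerCake τ x n y|) (f := fun _ => 0)
    (fun y => heatKernel τ (x - y))
    (fun n => ((integrable_heatKernel hτ x).sub (integrable_layerCake τ x n)).abs.1)
    (integrable_heatKernel hτ x) (fun n => ?_) ?_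
  · simpa using h
  · filter_upwards [layerCake_bounds hτ x] with y hy
    rw [Real.norm_eq_abs, abs_abs]
    exact (hy n).1
  · filter_upwards [layerCake_bounds hτ x] with y hy
    refine squeeze_zero' (Eventually.of_forall fun n => abs_nonneg _) ?_
      (tendsto_const_div_atTop_nhds_zero_nat (heatMax τ))
    filter_upwards [eventually_ne_atTop 0] with n hn
    exact (hy n).2 hn

lemma fourierT_layerCake (τ x : ℝ) (n : ℕ) (ξ : ℝ) :
    fourierT (layerCake τ x n) ξ = ∑ k ∈ Finset.range n, (heatMax τ / n)
      • fourierT (ioc (x - levelRadius τ n k) (x + levelRadius τ n k)) ξ :=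
  fourierT_sum _ (fun _ => heatMax τ / n) (fun _ => integrable_ioc _ _) ξ

lemma levelRadius_le (τ x : ℝ) (n k : ℕ) : x - levelRadius τ n k ≤ x + levelRadius τ n k := by
  have : 0 ≤ levelRadius τ n k := Real.sqrt_nonneg _
  linarith

/-- The reason for slicing horizontally: `n` intervals of weight `heatMax τ / n` each contribute
`2/|ξ|`, so the decay in `ξ` is uniform in `n`. Without it there would be no dominating function at
high frequency. -/
lemma norm_fourierT_layerCake_le (τ x : ℝ) (n : ℕ) {ξ : ℝ} (hξ : ξ ≠ 0) :
    ‖fourierT (layerCake τ x n) ξ‖ ≤ 2 * heatMax τ / |ξ| := by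
  have hM := heatMax_nonneg τ
  rw [fourierT_layerCake]
  refine (norm_sum_le_of_le (f := fun k => (heatMax τ / n)
      • fourierT (ioc (x - levelRadius τ n k) (x + levelRadius τ n k)) ξ) (Finset.range n)
    (n := fun _ => heatMax τ / n * (2 / |ξ|)) fun k _ => ?_).trans ?_
  · rw [norm_smul, Real.norm_eq_abs, abs_of_nonneg (by positivity)]
    gcongr
    exact norm_fourierT_ioc_le (levelRadius_le τ x n k) hξ
  · rw [Finset.sum_const, Finset.card_range, nsmul_eq_mul]
    rcases Nat.eq_zero_or_pos n with rfl | hn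
    · simp; positivity
    · have hn' : (0 : ℝ) < n := by exact_mod_cast hn
      apply le_of_eq
      field_simp

lemma measurable_fourierT_layerCake (τ x : ℝ) (n : ℕ) : Measurable (fourierT (layerCake τ x n)) := by
  have h : fourierT (layerCake τ x n) = fun ξ => ∑ k ∈ Finset.range n, (heatMax τ / n)
      • fourierT (ioc (x - levelRadius τ n k) (x + levelRadius τ n k)) ξ := by
    ext ξ
    exact fourierT_layerCake τ x n ξ
  rw [h]
  exact Finset.measurable_fun_sum _ fun k _ => (measurable_fourierT_ioc
    (x - levelRadius τ n k) (x + levelRadius τ n k)).const_smul (heatMax τ / n)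

lemma norm_heatFourier_sub_layerCake_le {τ : ℝ} (hτ : 0 < τ) (x : ℝ) (n : ℕ) (ξ : ℝ) :
    ‖heatFourier τ x ξ - fourierT (layerCake τ x n) ξ‖
      ≤ ∫ y, |heatKernel τ (x - y) - layerCake τ x n y| := by
  rw [← fourierT_heatKernel hτ, ← fourierT_sub (integrable_heatKernel hτ x)
    (integrable_layerCake τ x n)]
  exact norm_fourierT_le _ ξ

lemma tendsto_fourierT_layerCake {τ : ℝ} (hτ : 0 < τ) (x ξ : ℝ) :
    Tendsto (fun n => ‖heatFourier τ x ξ - fourierT (layerCake τ x n) ξ‖) atTop (𝓝 0) :=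
  squeeze_zero (fun _ => norm_nonneg _) (fun n => norm_heatFourier_sub_layerCake_le hτ x n ξ)
    (tendsto_integral_abs_layerCake hτ x)

lemma norm_heatFourier_sub_layerCake_le_one {τ : ℝ} (hτ : 0 < τ) (x : ℝ) (n : ℕ) (ξ : ℝ) :
    ‖heatFourier τ x ξ - fourierT (layerCake τ x n) ξ‖ ≤ 1 := by
  refine (norm_heatFourier_sub_layerCake_le hτ x n ξ).trans ?_
  have h1 : ∫ y, heatKernel τ (x - y) = 1 := by
    simpa using integral_heatKernel_mul hτ x (f := fun _ => 1) continuous_const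
  rw [← h1]
  refine integral_mono_ae ((integrable_heatKernel hτ x).sub (integrable_layerCake τ x n)).abs
    (integrable_heatKernel hτ x) ?_
  filter_upwards [layerCake_bounds hτ x] with y hy
  exact (hy n).1

lemma norm_heatFourier_sub_layerCake_le_div {τ : ℝ} (hτ : 0 < τ) (x : ℝ) (n : ℕ) {ξ : ℝ}
    (hξ : ξ ≠ 0) :
    ‖heatFourier τ x ξ - fourierT (layerCake τ x n) ξ‖ ≤ 4 * heatMax τ / |ξ| := by
  have h1 : ‖heatFourier τ x ξ‖ ≤ 2 * heatMax τ / |ξ| := by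
    have h2 : Tendsto (fun n => fourierT (layerCake τ x n) ξ) atTop (𝓝 (heatFourier τ x ξ)) := by
      rw [tendsto_iff_norm_sub_tendsto_zero]
      simpa only [norm_sub_rev] using tendsto_fourierT_layerCake hτ x ξ
    exact le_of_tendsto' h2.norm fun n => norm_fourierT_layerCake_le τ x n hξ
  calc _ ≤ 2 * heatMax τ / |ξ| + 2 * heatMax τ / |ξ| :=
        (norm_sub_le _ _).trans (add_le_add h1 (norm_fourierT_layerCake_le τ x n hξ))
    _ = _ := by ring

lemma measurable_heatFourier (τ x : ℝ) : Measurable (heatFourier τ x) := by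
  have h : Continuous (heatFourier τ x) := by unfold heatFourier; fun_prop
  exact h.measurable

/-- The layer-cake approximations converge in the spatial norm. -/
lemma tendsto_lintegral_layerCake {H : ℝ} (hH0 : 0 < H) (hH1 : H < 1) {τ : ℝ} (hτ : 0 < τ)
    (x : ℝ) :
    Tendsto (fun n => ∫⁻ ξ, ‖heatFourier τ x ξ - fourierT (layerCake τ x n) ξ‖ₑ ^ 2
      ∂(spectralMeasure H)) atTop (𝓝 0) := by
  have hC := CH_pos hH0 hH1
  set c := 1 + (4 * heatMax τ) ^ 2 with hc
  have h := tendsto_lintegral_of_dominated_convergence (μ := spectralMeasure H)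
    (F := fun n ξ => ‖heatFourier τ x ξ - fourierT (layerCake τ x n) ξ‖ₑ ^ 2) (f := fun _ => 0)
    -- The error is at most `1` and at most `4 heatMax / |ξ|`, so its square is at most `c/(1+ξ²)`.
    -- This majorant is larger still, and its integral is known from `lintegral_one_sub_exp`.
    (fun ξ => ENNReal.ofReal (c * ((1 - Real.exp (-(1 * ξ ^ 2))) / ξ ^ 2)))
    (fun n => ((measurable_heatFourier τ x).sub
      (measurable_fourierT_layerCake τ x n)).enorm.pow_const 2) (fun n => ?_) ?_ ?_
  · simpa using h
  · have hne : ∀ᵐ ξ ∂(spectralMeasure H), ξ ≠ 0 :=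
      (withDensity_absolutelyContinuous _ _).ae_le (Measure.ae_ne volume (0 : ℝ))
    filter_upwards [hne] with ξ hξ
    rw [← ofReal_norm, ← ENNReal.ofReal_pow (norm_nonneg _)]
    refine ENNReal.ofReal_le_ofReal ?_
    have h1 := norm_heatFourier_sub_layerCake_le_one hτ x n ξ
    have h2 := norm_heatFourier_sub_layerCake_le_div hτ x n hξ
    set d := ‖heatFourier τ x ξ - fourierT (layerCake τ x n) ξ‖
    have hd : 0 ≤ d := norm_nonneg _
    have hξ2 : 0 < ξ ^ 2 := by positivity
    have h3 : d ^ 2 * ξ ^ 2 ≤ (4 * heatMax τ) ^ 2 := by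
      rw [le_div_iff₀ (abs_pos.2 hξ)] at h2
      rw [← sq_abs ξ, ← mul_pow]
      gcongr
    have h4 : d ^ 2 * (1 + ξ ^ 2) ≤ c := by
      have : d ^ 2 ≤ 1 := pow_le_one₀ hd h1
      rw [hc]; linarith
    have h5 : ξ ^ 2 / (1 + ξ ^ 2) ≤ 1 - Real.exp (-(1 * ξ ^ 2)) := by
      have h6 : (1 + ξ ^ 2) * Real.exp (-(1 * ξ ^ 2)) ≤ 1 := by
        have := Real.add_one_le_exp (ξ ^ 2)
        rw [one_mul, Real.exp_neg, ← div_eq_mul_inv, div_le_one (Real.exp_pos _)]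
        linarith
      rw [div_le_iff₀ (by positivity)]
      linarith
    calc d ^ 2 ≤ c / (1 + ξ ^ 2) := (le_div_iff₀ (by positivity)).2 h4
      _ = c * (ξ ^ 2 / (1 + ξ ^ 2) / ξ ^ 2) := by field_simp
      _ ≤ _ := by
        gcongr
  · rw [lintegral_spectralMeasure H (by fun_prop)]
    have h1 : ∫⁻ ξ : ℝ, ENNReal.ofReal (CH H * |ξ| ^ (1 - 2 * H))
        * ENNReal.ofReal (c * ((1 - Real.exp (-(1 * ξ ^ 2))) / ξ ^ 2))
        = ENNReal.ofReal (CH H * c) * ∫⁻ ξ : ℝ,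
          ENNReal.ofReal ((1 - Real.exp (-(1 * ξ ^ 2))) * |ξ| ^ (-1 - 2 * H)) := by
      rw [← lintegral_const_mul _ (by fun_prop)]
      refine lintegral_congr_ae ?_
      filter_upwards [Measure.ae_ne volume (0 : ℝ)] with ξ hξ
      rw [← ENNReal.ofReal_mul (by positivity), ← ENNReal.ofReal_mul (by positivity),
        abs_rpow_neg_eq hξ]
      congr 1; ring
    rw [h1, lintegral_one_sub_exp hH0 hH1 zero_le_one]
    exact ENNReal.mul_ne_top ENNReal.ofReal_ne_top ENNReal.ofReal_ne_top
  · refine ae_of_all _ fun ξ => ?_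
    have h1 := ((tendsto_fourierT_layerCake hτ x ξ).pow 2)
    have h2 := ENNReal.tendsto_ofReal h1
    simp only [zero_pow two_ne_zero, ENNReal.ofReal_zero] at h2
    refine h2.congr fun n => ?_
    rw [ENNReal.ofReal_pow (norm_nonneg _), ofReal_norm]

/-! ### Approximation by step functions in the space of integrands -/

lemma tendsto_zero_of_sq {ι : Type*} {l : Filter ι} {a : ι → ℝ≥0∞}
    (h : Tendsto (fun i => a i ^ 2) l (𝓝 0)) : Tendsto a l (𝓝 0) := by
  have h1 := (ENNReal.continuous_rpow_const (y := (1 / 2 : ℝ))).tendsto 0 |>.comp h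
  rw [ENNReal.zero_rpow_of_pos (by norm_num)] at h1
  refine h1.congr fun i => ?_
  simp only [Function.comp]
  rw [← ENNReal.rpow_natCast, ← ENNReal.rpow_mul]
  norm_num

lemma fourierT_add {f g : ℝ → ℝ} (hf : Integrable f) (hg : Integrable g) (ξ : ℝ) :
    fourierT (f + g) ξ = fourierT f ξ + fourierT g ξ := by
  unfold fourierT
  rw [← integral_add (integrable_exp_mul hf ξ) (integrable_exp_mul hg ξ)]
  congr 1 with y
  simp [mul_add]

/-- The Fourier transform in space of a step function. -/
def stepFourier {T : ℝ} (f : Rect T →₀ ℝ) (q : ℝ × ℝ) : ℂ := fourierT (stepFun T f q.1) q.2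

lemma measurable_stepFourier {T : ℝ} (f : Rect T →₀ ℝ) : Measurable (stepFourier f) :=
  measurable_fourierT (measurable_stepFun T f)

lemma stepFourier_add {T : ℝ} (f g : Rect T →₀ ℝ) :
    stepFourier (f + g) = stepFourier f + stepFourier g := by
  ext q
  simp only [stepFourier, map_add, Pi.add_apply]
  exact fourierT_add (integrable_stepFun T f _) (integrable_stepFun T g _) _

lemma stepFourier_sub {T : ℝ} (f g : Rect T →₀ ℝ) :
    stepFourier (f - g) = stepFourier f - stepFourier g := by
  ext q
  simp only [stepFourier, map_sub, Pi.sub_apply]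
  exact fourierT_sub (integrable_stepFun T f _) (integrable_stepFun T g _) _

lemma stepFourier_single {T : ℝ} (R : Rect T) (c : ℝ) (q : ℝ × ℝ) :
    stepFourier (Finsupp.single R c) q
      = c * (ioc R.s R.t q.1 * fourierT (ioc R.a R.b) q.2) := by
  rw [stepFourier, stepFun, Finsupp.linearCombination_single, ← R.fourierT_ind,
    ← fourierT_const_mul]
  rfl

/-- `Φ` belongs to the closure of the Fourier transforms of step functions. -/
def StepApprox (H T : ℝ) (Φ : ℝ × ℝ → ℂ) : Prop :=
  AEStronglyMeasurable Φ (phaseMeasure H T) ∧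
    ∀ ε : ℝ≥0∞, ε ≠ 0 → ∃ f : Rect T →₀ ℝ, eLpNorm (Φ - stepFourier f) 2 (phaseMeasure H T) ≤ ε

lemma StepApprox.stepFourier {H T : ℝ} (f : Rect T →₀ ℝ) :
    StepApprox H T (stepFourier f) :=
  ⟨(measurable_stepFourier f).aestronglyMeasurable, fun ε _ => ⟨f, by simp⟩⟩

lemma StepApprox.add {H T : ℝ} {Φ Ψ : ℝ × ℝ → ℂ} (hΦ : StepApprox H T Φ) (hΨ : StepApprox H T Ψ) :
    StepApprox H T (Φ + Ψ) := by
  refine ⟨hΦ.1.add hΨ.1, fun ε hε => ?_⟩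
  have hε2 : ε / 2 ≠ 0 := ENNReal.div_ne_zero.2 ⟨hε, ENNReal.ofNat_ne_top⟩
  obtain ⟨f, hf⟩ := hΦ.2 _ hε2
  obtain ⟨g, hg⟩ := hΨ.2 _ hε2
  refine ⟨f + g, ?_⟩
  rw [stepFourier_add, add_sub_add_comm, ← ENNReal.add_halves ε]
  exact (eLpNorm_add_le (hΦ.1.sub (measurable_stepFourier f).aestronglyMeasurable)
    (hΨ.1.sub (measurable_stepFourier g).aestronglyMeasurable) one_le_two).trans
    (add_le_add hf hg)

lemma StepApprox.sum {H T : ℝ} {ι : Type*} (s : Finset ι) {Φ : ι → ℝ × ℝ → ℂ}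
    (h : ∀ i ∈ s, StepApprox H T (Φ i)) : StepApprox H T (fun q => ∑ i ∈ s, Φ i q) := by
  classical
  induction s using Finset.induction_on with
  | empty =>
    have h0 := StepApprox.stepFourier (H := H) (T := T) 0
    have e : FracHeat.stepFourier (0 : Rect T →₀ ℝ) = fun _ => 0 := by
      ext q
      simp [FracHeat.stepFourier, fourierT]
    rw [e] at h0
    simpa using h0
  | insert a s ha ih =>
    have h1 := (h a (Finset.mem_insert_self a s)).add
      (ih fun i hi => h i (Finset.mem_insert_of_mem hi))
    have e : (fun q => ∑ i ∈ insert a s, Φ i q) = Φ a + fun q => ∑ i ∈ s, Φ i q := by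
      ext q
      rw [Finset.sum_insert ha]
      rfl
    rwa [e]

/-- The closure is closed; this lets the discretizations in space and in time be carried out
separately. -/
lemma StepApprox.of_tendsto {H T : ℝ} {Φ : ℝ × ℝ → ℂ} {Ψ : ℕ → ℝ × ℝ → ℂ}
    (hΦ : AEStronglyMeasurable Φ (phaseMeasure H T)) (hΨ : ∀ n, StepApprox H T (Ψ n))
    (h : Tendsto (fun n => eLpNorm (Φ - Ψ n) 2 (phaseMeasure H T)) atTop (𝓝 0)) :
    StepApprox H T Φ := by
  refine ⟨hΦ, fun ε hε => ?_⟩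
  have hε2 : ε / 2 ≠ 0 := ENNReal.div_ne_zero.2 ⟨hε, ENNReal.ofNat_ne_top⟩
  obtain ⟨n, hn⟩ := (h.eventually (ge_mem_nhds hε2.bot_lt)).exists
  obtain ⟨f, hf⟩ := (hΨ n).2 _ hε2
  refine ⟨f, ?_⟩
  rw [← sub_add_sub_cancel Φ (Ψ n), ← ENNReal.add_halves ε]
  exact (eLpNorm_add_le (hΦ.sub (hΨ n).1)
    ((hΨ n).1.sub (measurable_stepFourier f).aestronglyMeasurable) one_le_two).trans
    (add_le_add hn hf)

lemma stepApprox_rect {H T s t a b : ℝ} (hs : 0 ≤ s) (hst : s ≤ t) (ht : t ≤ T) (hab : a ≤ b)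
    (c : ℝ) : StepApprox H T fun q => c * (ioc s t q.1 * fourierT (ioc a b) q.2) := by
  have h := StepApprox.stepFourier (H := H) (Finsupp.single (⟨s, t, a, b, hs, hst, ht, hab⟩ : Rect T) c)
  have e : stepFourier (Finsupp.single (⟨s, t, a, b, hs, hst, ht, hab⟩ : Rect T) c)
      = fun q => c * (ioc s t q.1 * fourierT (ioc a b) q.2) := by
    ext q
    exact stepFourier_single _ _ _
  rwa [e] at h

lemma abs_ioc_le_one (s t θ : ℝ) : |ioc s t θ| ≤ 1 := by
  by_cases h : θ ∈ Ioc s t <;> simp [ioc, h]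

/-- On a time slab, convergence in the spatial norm suffices, at the price of a factor `T`. -/
lemma eLpNorm_ioc_mul_sq_le (H T s t : ℝ) {D : ℝ → ℂ} (hD : Measurable D) :
    eLpNorm (fun q : ℝ × ℝ => ioc s t q.1 * D q.2) 2 (phaseMeasure H T) ^ 2
      ≤ ENNReal.ofReal T * ∫⁻ ξ, ‖D ξ‖ₑ ^ 2 ∂(spectralMeasure H) := by
  have hm : Measurable fun q : ℝ × ℝ => (ioc s t q.1 : ℂ) * D q.2 :=
    (Complex.measurable_ofReal.comp ((measurable_ioc s t).comp measurable_fst)).mul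
      (hD.comp measurable_snd)
  rw [sq_eLpNorm_two, phaseMeasure, lintegral_prod _ (hm.enorm.pow_const 2).aemeasurable]
  calc _ ≤ ∫⁻ _ in Icc 0 T, ∫⁻ ξ, ‖D ξ‖ₑ ^ 2 ∂(spectralMeasure H) := by
        refine lintegral_mono fun θ => lintegral_mono fun ξ => ?_
        gcongr
        rw [enorm_mul]
        refine mul_le_of_le_one_left' ?_
        rw [← ofReal_norm, Complex.norm_real, ENNReal.ofReal_le_one]
        exact abs_ioc_le_one s t θ
    _ = _ := by
        rw [lintegral_const, Measure.restrict_apply_univ, Real.volume_Icc, sub_zero, mul_comm]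

lemma stepApprox_slab {H T s t τ : ℝ} (hH0 : 0 < H) (hH1 : H < 1) (hs : 0 ≤ s) (hst : s ≤ t)
    (ht : t ≤ T) (hτ : 0 < τ) (x : ℝ) :
    StepApprox H T fun q => ioc s t q.1 * heatFourier τ x q.2 := by
  have hm : Measurable fun q : ℝ × ℝ => (ioc s t q.1 : ℂ) * heatFourier τ x q.2 :=
    (Complex.measurable_ofReal.comp ((measurable_ioc s t).comp measurable_fst)).mul
      ((measurable_heatFourier τ x).comp measurable_snd)
  refine StepApprox.of_tendsto (Ψ := fun n q => ioc s t q.1 * fourierT (layerCake τ x n) q.2)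
    hm.aestronglyMeasurable (fun n => ?_) ?_
  · have e : (fun q : ℝ × ℝ => (ioc s t q.1 : ℂ) * fourierT (layerCake τ x n) q.2)
        = fun q => ∑ k ∈ Finset.range n, (heatMax τ / n : ℝ) * (ioc s t q.1
          * fourierT (ioc (x - levelRadius τ n k) (x + levelRadius τ n k)) q.2) := by
      ext q
      rw [fourierT_layerCake, Finset.mul_sum]
      refine Finset.sum_congr rfl fun k _ => ?_
      rw [Complex.real_smul]
      ring
    rw [e]
    exact StepApprox.sum _ fun k _ => stepApprox_rect hs hst ht (levelRadius_le τ x n k) _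
  · refine tendsto_zero_of_sq ?_
    have h1 := ENNReal.Tendsto.const_mul (tendsto_lintegral_layerCake hH0 hH1 hτ x)
      (Or.inr (ENNReal.ofReal_ne_top (r := T)))
    rw [mul_zero] at h1
    refine tendsto_of_tendsto_of_tendsto_of_le_of_le tendsto_const_nhds h1 (fun _ => zero_le)
      fun n => ?_
    refine le_trans (le_of_eq ?_) (eLpNorm_ioc_mul_sq_le H T s t
      ((measurable_heatFourier τ x).sub (measurable_fourierT_layerCake τ x n)))
    congr 2
    ext q
    simp only [Pi.sub_apply]
    ring

/-! ### Discretization in time of the convolution kernel -/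

lemma exists_grid {t θ : ℝ} (ht : 0 < t) (hθ : θ ∈ Ioc 0 t) (n : ℕ) :
    ∃ i : ℕ, i * (t / (n + 1)) < θ ∧ θ ≤ (i + 1) * (t / (n + 1)) ∧ ∀ g : ℕ → ℂ,
      ∑ j ∈ Finset.range (n + 1),
        ioc (j * (t / (n + 1))) ((j + 1) * (t / (n + 1))) θ * g j = g i := by
  set δ := t / (n + 1) with hδ
  have hδ0 : 0 < δ := by positivity
  have hpos : 0 < θ / δ := div_pos hθ.1 hδ0
  have hc : 0 < ⌈θ / δ⌉₊ := Nat.ceil_pos.2 hpos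
  -- The ceiling, not the floor, matches cells that are open on the left and closed on the right.
  obtain ⟨i, hi⟩ : ∃ i, ⌈θ / δ⌉₊ = i + 1 := ⟨⌈θ / δ⌉₊ - 1, by omega⟩
  have h1 : (i : ℝ) < θ / δ := Nat.lt_ceil.1 (by omega)
  have h2 : θ / δ ≤ (i : ℝ) + 1 := by
    have := Nat.le_ceil (θ / δ)
    rw [hi] at this
    exact_mod_cast this
  rw [lt_div_iff₀ hδ0] at h1
  rw [div_le_iff₀ hδ0] at h2
  have hin : i < n + 1 := by
    have h3 : (i : ℝ) * δ < (n + 1) * δ := by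
      refine h1.trans_le (hθ.2.trans_eq ?_)
      rw [hδ]; field_simp
    have h4 := lt_of_mul_lt_mul_right h3 hδ0.le
    exact_mod_cast h4
  refine ⟨i, h1, h2, fun g => ?_⟩
  rw [Finset.sum_eq_single i]
  · have : θ ∈ Ioc (i * δ) ((i + 1) * δ) := ⟨h1, h2⟩
    simp [ioc, this]
  · intro j _ hj
    have : θ ∉ Ioc (j * δ) ((j + 1) * δ) := by
      rintro ⟨h3, h4⟩
      have h5 : (j : ℝ) < i + 1 := lt_of_mul_lt_mul_right (h3.trans_le h2) hδ0.le
      have h6 : (i : ℝ) < j + 1 := lt_of_mul_lt_mul_right (h1.trans_le h4) hδ0.le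
      have h5' : j < i + 1 := by exact_mod_cast h5
      have h6' : i < j + 1 := by exact_mod_cast h6
      omega
    simp [ioc, this]
  · intro h
    exact absurd (Finset.mem_range.2 hin) h

/-- Discretization in time, at left endpoints, of the Fourier transform of the kernel. -/
def timeDiscretization (t x : ℝ) (n : ℕ) (q : ℝ × ℝ) : ℂ :=
  ∑ j ∈ Finset.range (n + 1), ioc (j * (t / (n + 1))) ((j + 1) * (t / (n + 1))) q.1
    * heatFourier (t - j * (t / (n + 1))) x q.2

lemma stepApprox_timeDiscretization {H T t : ℝ} (hH0 : 0 < H) (hH1 : H < 1) (ht : t ∈ Ioc 0 T)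
    (x : ℝ) (n : ℕ) : StepApprox H T (timeDiscretization t x n) := by
  have ht0 := ht.1
  refine StepApprox.sum _ fun j hj => ?_
  have hj1 : (j : ℝ) + 1 ≤ n + 1 := by exact_mod_cast Finset.mem_range.1 hj
  have hδ : 0 < t / (n + 1) := by positivity
  have he : ((n : ℝ) + 1) * (t / (n + 1)) = t := by field_simp
  have h1 : ((j : ℝ) + 1) * (t / (n + 1)) ≤ t := by
    calc _ ≤ ((n : ℝ) + 1) * (t / (n + 1)) := by gcongr
      _ = t := he
  refine stepApprox_slab hH0 hH1 (by positivity) ?_ (h1.trans ht.2) ?_ x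
  · gcongr
    linarith
  · linarith

lemma timeDiscretization_eq_zero {t x θ : ℝ} (ht : 0 < t) (hθ : t < θ) (n : ℕ) (ξ : ℝ) :
    timeDiscretization t x n (θ, ξ) = 0 := by
  refine Finset.sum_eq_zero fun j hj => ?_
  have hj1 : (j : ℝ) + 1 ≤ n + 1 := by exact_mod_cast Finset.mem_range.1 hj
  have h1 : ((j : ℝ) + 1) * (t / (n + 1)) ≤ t := by
    calc _ ≤ ((n : ℝ) + 1) * (t / (n + 1)) := by gcongr
      _ = t := by field_simp
  have : θ ∉ Ioc (j * (t / (n + 1))) ((j + 1) * (t / (n + 1))) := fun h => by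
    linarith [h.2]
  simp [ioc, this]

/-- Left endpoints leave more remaining time, hence more damping, so the limit itself dominates the
discretizations. In particular the last cell avoids the singular time `θ = t`. -/
lemma norm_timeDiscretization_le {t x θ : ℝ} (hθ : θ ∈ Ioo 0 t) (n : ℕ) (ξ : ℝ) :
    ‖timeDiscretization t x n (θ, ξ)‖ ≤ ‖heatFourier (t - θ) x ξ‖ := by
  obtain ⟨i, h1, _, h3⟩ := exists_grid (hθ.1.trans hθ.2) ⟨hθ.1, hθ.2.le⟩ n
  have e : timeDiscretization t x n (θ, ξ) = heatFourier (t - i * (t / (n + 1))) x ξ :=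
    h3 fun j => heatFourier (t - j * (t / (n + 1))) x ξ
  rw [e, norm_heatFourier, norm_heatFourier, Real.exp_le_exp]
  nlinarith [mul_nonneg (sq_nonneg ξ) (sub_nonneg.2 h1.le)]

lemma tendsto_timeDiscretization {t x θ : ℝ} (hθ : θ ∈ Ioo 0 t) (ξ : ℝ) :
    Tendsto (fun n => timeDiscretization t x n (θ, ξ)) atTop (𝓝 (heatFourier (t - θ) x ξ)) := by
  choose i h1 h2 h3 using exists_grid (hθ.1.trans hθ.2) (⟨hθ.1, hθ.2.le⟩ : θ ∈ Ioc 0 t)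
  have e : ∀ n, timeDiscretization t x n (θ, ξ) = heatFourier (t - i n * (t / (n + 1))) x ξ :=
    fun n => h3 n fun j => heatFourier (t - j * (t / (n + 1))) x ξ
  simp_rw [e]
  have hc : Continuous fun τ => heatFourier (t - τ) x ξ := by
    unfold heatFourier; fun_prop
  refine (hc.tendsto θ).comp ?_
  have hδ : Tendsto (fun n : ℕ => θ - t / ((n : ℝ) + 1)) atTop (𝓝 θ) := by
    have h4 := (tendsto_const_div_atTop_nhds_zero_nat t).comp (tendsto_add_atTop_nat 1)
    have h5 := (tendsto_const_nhds (x := θ)).sub h4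
    rw [sub_zero] at h5
    refine h5.congr fun n => ?_
    simp
  refine tendsto_of_tendsto_of_tendsto_of_le_of_le hδ tendsto_const_nhds (fun n => ?_)
    (fun n => (h1 n).le)
  have := h2 n
  simp only
  linarith

lemma ae_phaseMeasure_of_ae {H T : ℝ} {p : ℝ → Prop} (h : ∀ᵐ θ, p θ) :
    ∀ᵐ q ∂(phaseMeasure H T), p q.1 :=
  Measure.quasiMeasurePreserving_fst.ae (ae_restrict_of_ae h)

/-- The kernel of the stochastic convolution lies in the closure of the step functions. -/
lemma stepApprox_convKernel {H T t : ℝ} (hH0 : 0 < H) (hH1 : H < 1) (ht : t ∈ Ioc 0 T) (x : ℝ) :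
    StepApprox H T fun q => fourierT (convKernel t x q.1) q.2 := by
  have ht0 := ht.1
  have hm := measurable_fourierT (measurable_convKernel t x)
  refine StepApprox.of_tendsto hm.aestronglyMeasurable
    (stepApprox_timeDiscretization hH0 hH1 ht x) (tendsto_zero_of_sq ?_)
  simp_rw [sq_eLpNorm_two]
  have hmd : ∀ n, Measurable (timeDiscretization t x n) := fun n =>
    Finset.measurable_fun_sum _ fun j _ => (Complex.measurable_ofReal.comp
      ((measurable_ioc _ _).comp measurable_fst)).mul
      ((measurable_heatFourier _ _).comp measurable_snd)
  -- The times `0` and `t`, where the half-open conventions of kernel and cells disagree, form a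
  -- null set.
  have hgood : ∀ᵐ q ∂(phaseMeasure H T), q.1 ∈ Ioo 0 t ∨ t < q.1 := by
    filter_upwards [ae_mem_phaseMeasure H T,
      ae_phaseMeasure_of_ae (Measure.ae_ne volume (0 : ℝ)),
      ae_phaseMeasure_of_ae (Measure.ae_ne volume t)] with q h1 h2 h3
    rcases lt_or_gt_of_ne h3 with h4 | h4
    · exact Or.inl ⟨lt_of_le_of_ne h1.1 (Ne.symm h2), h4⟩
    · exact Or.inr h4
  have h := tendsto_lintegral_of_dominated_convergence (μ := phaseMeasure H T)
    (F := fun n q => ‖fourierT (convKernel t x q.1) q.2 - timeDiscretization t x n q‖ₑ ^ 2)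
    (f := fun _ => 0) (fun q => 4 * ‖fourierT (convKernel t x q.1) q.2‖ₑ ^ 2)
    (fun n => (hm.sub (hmd n)).enorm.pow_const 2) (fun n => ?_) ?_ ?_
  · simpa using h
  · filter_upwards [hgood] with q hq
    have h1 : ‖timeDiscretization t x n q‖ ≤ ‖fourierT (convKernel t x q.1) q.2‖ := by
      rcases hq with hq | hq
      · rw [fourierT_convKernel, if_pos ⟨hq.1.le, hq.2⟩]
        exact norm_timeDiscretization_le hq n q.2
      · have h2 := timeDiscretization_eq_zero (x := x) ht0 hq n q.2
        rw [Prod.mk.eta] at h2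
        rw [h2, norm_zero]
        exact norm_nonneg _
    have h2 : ‖fourierT (convKernel t x q.1) q.2 - timeDiscretization t x n q‖
        ≤ 2 * ‖fourierT (convKernel t x q.1) q.2‖ := by
      refine (norm_sub_le _ _).trans ?_
      linarith
    rw [← ofReal_norm, ← ofReal_norm, ← ENNReal.ofReal_pow (norm_nonneg _),
      ← ENNReal.ofReal_pow (norm_nonneg _), ← ENNReal.ofReal_ofNat 4,
      ← ENNReal.ofReal_mul (by norm_num)]
    refine ENNReal.ofReal_le_ofReal ?_
    calc _ ≤ (2 * ‖fourierT (convKernel t x q.1) q.2‖) ^ 2 := by gcongr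
      _ = _ := by ring
  · rw [lintegral_const_mul _ (hm.enorm.pow_const 2), ← sq_eLpNorm_two,
      ← integrandNormSq_eq H T (measurable_convKernel t x)]
    exact ENNReal.mul_ne_top ENNReal.ofNat_ne_top
      (ne_top_of_le_ne_top ENNReal.ofReal_ne_top (integrandNormSq_convKernel_le hH0 hH1 ht0 x))
  · filter_upwards [hgood] with q hq
    have h1 : Tendsto (fun n => timeDiscretization t x n q) atTop
        (𝓝 (fourierT (convKernel t x q.1) q.2)) := by
      rcases hq with hq | hq
      · rw [fourierT_convKernel, if_pos ⟨hq.1.le, hq.2⟩]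
        exact tendsto_timeDiscretization hq q.2
      · rw [fourierT_convKernel, if_neg fun h => absurd h.2 (not_lt.2 hq.le)]
        refine tendsto_const_nhds.congr fun n => ?_
        have h2 := timeDiscretization_eq_zero (x := x) ht0 hq n q.2
        rw [Prod.mk.eta] at h2
        exact h2.symm
    have h2 : Continuous fun z : ℂ => ‖fourierT (convKernel t x q.1) q.2 - z‖ₑ ^ 2 := by
      fun_prop
    have h3 := (h2.tendsto _).comp h1
    simpa [Function.comp_def] using h3

/-! ### Properties of the Wiener integral -/

section wiener

variable {Ω : Type*} [MeasurableSpace Ω] {P : Measure Ω} {H T : ℝ} {W : ℝ → ℝ → Ω → ℝ}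
  {φ ψ : ℝ → ℝ → ℝ} {I J : Ω → ℝ}

/-- Passage to the phase space `L²`, where the triangle inequality and completeness arguments take
place. Integrability of the slices makes the Fourier transform additive. -/
lemma integrandNormSq_sub_stepFun (H : ℝ) (hφ : Measurable (Function.uncurry φ))
    (hi : ∀ θ ∈ Icc 0 T, Integrable (φ θ)) (f : Rect T →₀ ℝ) :
    integrandNormSq H T (φ - stepFun T f)
      = eLpNorm ((fun q : ℝ × ℝ => fourierT (φ q.1) q.2) - stepFourier f) 2 (phaseMeasure H T) ^ 2 := by
  have hm : Measurable (Function.uncurry (φ - stepFun T f)) := hφ.sub (measurable_stepFun T f)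
  rw [integrandNormSq_eq H T hm]
  congr 1
  refine eLpNorm_congr_ae ?_
  filter_upwards [ae_mem_phaseMeasure H T] with q hq
  exact fourierT_sub (hi _ hq) (integrable_stepFun T f _) _

lemma IsFractionalNoise.eLpNorm_stepIntegral (hW : IsFractionalNoise P H T W) (hH0 : 0 < H)
    (hH1 : H < 1) (f : Rect T →₀ ℝ) :
    eLpNorm (stepIntegral T W f) 2 P = eLpNorm (stepFourier f) 2 (phaseMeasure H T) := by
  refine (ENNReal.pow_right_strictMono two_ne_zero).injective ?_
  rw [hW.eLpNorm_stepIntegral_sq hH0 hH1, integrandNormSq_eq H T (measurable_stepFun T f)]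
  rfl

lemma IsWienerIntegral.sub (hW : IsFractionalNoise P H T W) (hI : IsWienerIntegral P H T W φ I)
    (hJ : IsWienerIntegral P H T W ψ J) : IsWienerIntegral P H T W (φ - ψ) (I - J) := by
  obtain ⟨f, hf1, hf2⟩ := hI.exists_approx
  obtain ⟨g, hg1, hg2⟩ := hJ.exists_approx
  refine ⟨hI.measurable_integrand.sub hJ.measurable_integrand,
    fun θ hθ => (hI.integrable_integrand θ hθ).sub (hJ.integrable_integrand θ hθ),
    hI.memLp.sub hJ.memLp, fun n => f n - g n, ?_, ?_⟩
  · have hm : Measurable (Function.uncurry (φ - ψ)) :=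
      hI.measurable_integrand.sub hJ.measurable_integrand
    simp_rw [integrandNormSq_sub_stepFun H hI.measurable_integrand hI.integrable_integrand] at hf1
    simp_rw [integrandNormSq_sub_stepFun H hJ.measurable_integrand hJ.integrable_integrand] at hg1
    simp_rw [integrandNormSq_sub_stepFun H hm
      fun θ hθ => (hI.integrable_integrand θ hθ).sub (hJ.integrable_integrand θ hθ)]
    have h := (tendsto_zero_of_sq hf1).add (tendsto_zero_of_sq hg1)
    rw [add_zero] at h
    have h0 : Tendsto (fun n => eLpNorm ((fun q : ℝ × ℝ => fourierT ((φ - ψ) q.1) q.2)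
        - stepFourier (f n - g n)) 2 (phaseMeasure H T)) atTop (𝓝 0) := by
      refine tendsto_of_tendsto_of_tendsto_of_le_of_le tendsto_const_nhds h (fun _ => zero_le)
        fun n => ?_
      refine le_trans (le_of_eq ?_) (eLpNorm_sub_le
        ((measurable_fourierT hI.measurable_integrand).sub
          (measurable_stepFourier (f n))).aestronglyMeasurable
        ((measurable_fourierT hJ.measurable_integrand).sub
          (measurable_stepFourier (g n))).aestronglyMeasurable one_le_two)
      refine eLpNorm_congr_ae ?_
      filter_upwards [ae_mem_phaseMeasure H T] with q hq
      have e := fourierT_sub (hI.integrable_integrand _ hq) (hJ.integrable_integrand _ hq) q.2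
      simp only [Pi.sub_apply, stepFourier_sub] at e ⊢
      rw [e]
      ring
    have h1 := ENNReal.Tendsto.pow (n := 2) h0
    simpa using h1
  · have h := hf2.add hg2
    rw [add_zero] at h
    refine tendsto_of_tendsto_of_tendsto_of_le_of_le tendsto_const_nhds h (fun _ => zero_le)
      fun n => ?_
    refine le_trans (le_of_eq ?_) (eLpNorm_sub_le
      (hI.memLp.sub (hW.memLp_stepIntegral (f n))).1
      (hJ.memLp.sub (hW.memLp_stepIntegral (g n))).1 one_le_two)
    congr 1
    rw [map_sub]
    abel

/-- The Wiener integral is a contraction (in fact an isometry). -/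
lemma IsWienerIntegral.eLpNorm_sq_le (hW : IsFractionalNoise P H T W) (hH0 : 0 < H) (hH1 : H < 1)
    (hI : IsWienerIntegral P H T W φ I) : eLpNorm I 2 P ^ 2 ≤ integrandNormSq H T φ := by
  obtain ⟨f, hf1, hf2⟩ := hI.exists_approx
  simp_rw [integrandNormSq_sub_stepFun H hI.measurable_integrand hI.integrable_integrand] at hf1
  have hf1 := tendsto_zero_of_sq hf1
  rw [integrandNormSq_eq H T hI.measurable_integrand]
  gcongr
  set Φ := fun q : ℝ × ℝ => fourierT (φ q.1) q.2 with hΦ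
  have hm : Measurable Φ := measurable_fourierT hI.measurable_integrand
  have h := (hf2.add hf1).add (tendsto_const_nhds (x := eLpNorm Φ 2 (phaseMeasure H T)))
  rw [add_zero, zero_add] at h
  refine ge_of_tendsto' h fun n => ?_
  calc eLpNorm I 2 P
      = eLpNorm ((I - stepIntegral T W (f n)) + stepIntegral T W (f n)) 2 P := by
        rw [sub_add_cancel]
    _ ≤ eLpNorm (I - stepIntegral T W (f n)) 2 P + eLpNorm (stepIntegral T W (f n)) 2 P :=
        eLpNorm_add_le (hI.memLp.sub (hW.memLp_stepIntegral (f n))).1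
          (hW.memLp_stepIntegral (f n)).1 one_le_two
    _ = eLpNorm (I - stepIntegral T W (f n)) 2 P
          + eLpNorm (Φ - (Φ - stepFourier (f n))) 2 (phaseMeasure H T) := by
        rw [hW.eLpNorm_stepIntegral hH0 hH1, sub_sub_cancel]
    _ ≤ eLpNorm (I - stepIntegral T W (f n)) 2 P + (eLpNorm Φ 2 (phaseMeasure H T)
          + eLpNorm (Φ - stepFourier (f n)) 2 (phaseMeasure H T)) := by
        gcongr
        exact eLpNorm_sub_le hm.aestronglyMeasurable
          (hm.sub (measurable_stepFourier (f n))).aestronglyMeasurable one_le_two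
    _ = _ := by ring

/-- Existence of the Wiener integral of integrands that are limits of step functions. -/
lemma exists_isWienerIntegral (hW : IsFractionalNoise P H T W) (hH0 : 0 < H) (hH1 : H < 1)
    (hφ : Measurable (Function.uncurry φ)) (hi : ∀ θ ∈ Icc 0 T, Integrable (φ θ))
    (h : StepApprox H T fun q => fourierT (φ q.1) q.2) :
    ∃ I, IsWienerIntegral P H T W φ I := by
  set Φ := fun q : ℝ × ℝ => fourierT (φ q.1) q.2 with hΦ
  have hpow : ∀ n : ℕ, (2⁻¹ : ℝ≥0∞) ^ n ≠ 0 := fun n => pow_ne_zero n (by simp)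
  -- The exponent `n + 2` makes two errors sum to at most `2^{-(N+1)}`, strictly below the summable
  -- Cauchy bound `2^{-N}`.
  choose f hf using fun n : ℕ => h.2 ((2⁻¹ : ℝ≥0∞) ^ (n + 2)) (hpow _)
  have hm : Measurable Φ := measurable_fourierT hφ
  have hms := fun n => (hm.sub (measurable_stepFourier (f n))).aestronglyMeasurable
    (μ := phaseMeasure H T)
  have hcau : ∀ N n m : ℕ, N ≤ n → N ≤ m →
      eLpNorm (stepIntegral T W (f n) - stepIntegral T W (f m)) 2 P < (2⁻¹ : ℝ≥0∞) ^ N := by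
    intro N n m hn hm'
    have hle : ∀ k, N ≤ k → (2⁻¹ : ℝ≥0∞) ^ (k + 2) ≤ 2⁻¹ ^ (N + 2) := fun k hk =>
      pow_le_pow_right_of_le_one' (by simp) (by omega)
    rw [← map_sub, hW.eLpNorm_stepIntegral hH0 hH1, stepFourier_sub,
      ← sub_sub_sub_cancel_left _ _ Φ]
    calc _ ≤ eLpNorm (Φ - stepFourier (f m)) 2 (phaseMeasure H T)
          + eLpNorm (Φ - stepFourier (f n)) 2 (phaseMeasure H T) :=
          eLpNorm_sub_le (hms m) (hms n) one_le_two
      _ ≤ 2⁻¹ ^ (N + 2) + 2⁻¹ ^ (N + 2) :=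
          add_le_add ((hf m).trans (hle m hm')) ((hf n).trans (hle n hn))
      _ = 2⁻¹ ^ (N + 1) := by
          rw [pow_succ _ (N + 1), ← mul_add, ENNReal.inv_two_add_inv_two, mul_one]
      _ < 2⁻¹ ^ N := by
          rw [pow_succ]
          refine (ENNReal.mul_lt_mul_iff_right (hpow N) (ENNReal.pow_ne_top (by simp))).2 ?_ |>.trans_eq
            (mul_one _)
          exact ENNReal.one_half_lt_one
  obtain ⟨I, hI, hlim⟩ := Lp.cauchy_complete_eLpNorm one_le_two
    (fun n => hW.memLp_stepIntegral (f n)) (B := fun N => (2⁻¹ : ℝ≥0∞) ^ N)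
    (by rw [ENNReal.tsum_geometric]; simp) hcau
  refine ⟨I, hφ, hi, hI, f, ?_, ?_⟩
  · simp_rw [integrandNormSq_sub_stepFun H hφ hi]
    have h0 : Tendsto (fun n => eLpNorm (Φ - stepFourier (f n)) 2 (phaseMeasure H T)) atTop
        (𝓝 0) := by
      have h1 := (ENNReal.tendsto_pow_atTop_nhds_zero_of_lt_one
        (r := 2⁻¹) ENNReal.one_half_lt_one).comp (tendsto_add_atTop_nat 2)
      exact tendsto_of_tendsto_of_tendsto_of_le_of_le tendsto_const_nhds h1 (fun _ => zero_le) hf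
    have h1 := ENNReal.Tendsto.pow (n := 2) h0
    simpa using h1
  · refine hlim.congr fun n => ?_
    rw [← eLpNorm_neg, neg_sub]

/-! ### The stochastic convolution -/

lemma exists_isStochasticConvolution (hW : IsFractionalNoise P H T W) (hH0 : 0 < H) (hH1 : H < 1) :
    ∃ V : ℝ → ℝ → Ω → ℝ, IsStochasticConvolution P H T W V := by
  have h : ∀ t x, ∃ I : Ω → ℝ, t ∈ Ioc 0 T → IsWienerIntegral P H T W (convKernel t x) I := by
    intro t x
    by_cases ht : t ∈ Ioc 0 T
    · obtain ⟨I, hI⟩ := exists_isWienerIntegral hW hH0 hH1 (measurable_convKernel t x)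
        (fun θ _ => integrable_convKernel t x θ) (stepApprox_convKernel hH0 hH1 ht x)
      exact ⟨I, fun _ => hI⟩
    · exact ⟨0, fun h => absurd h ht⟩
  choose V hV using h
  exact ⟨V, fun t ht x => hV t x ht⟩

variable {V : ℝ → ℝ → Ω → ℝ}

lemma eLpNorm_two_le_of_sq_le {E : Type*} [NormedAddCommGroup E] {f : Ω → E} {c : ℝ} (hc : 0 ≤ c)
    {b : ℝ≥0∞} (h : eLpNorm f 2 P ^ 2 ≤ b) (hb : b ≤ ENNReal.ofReal (c ^ 2)) :
    eLpNorm f 2 P ≤ ENNReal.ofReal c := by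
  rw [← ENNReal.pow_le_pow_left_iff two_ne_zero, ← ENNReal.ofReal_pow hc]
  exact h.trans hb

lemma IsStochasticConvolution.eLpNorm_le (hV : IsStochasticConvolution P H T W V)
    (hW : IsFractionalNoise P H T W) (hH0 : 0 < H) (hH1 : H < 1) {t : ℝ} (ht : t ∈ Ioc 0 T)
    (x : ℝ) : eLpNorm (V t x) 2 P ≤ ENNReal.ofReal (AH H * t ^ (H / 2)) := by
  have ht0 := ht.1.le
  have hC := CH_pos hH0 hH1
  have hk : 0 ≤ kappaH H := by
    have := Real.Gamma_pos_of_pos (sub_pos.2 hH1)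
    unfold kappaH
    positivity
  refine eLpNorm_two_le_of_sq_le (mul_nonneg (Real.sqrt_nonneg _) (by positivity))
    ((hV t ht x).eLpNorm_sq_le hW hH0 hH1) ((integrandNormSq_convKernel_le hH0 hH1 ht.1 x).trans_eq ?_)
  rw [mul_pow, AH, Real.sq_sqrt (by positivity), ← Real.rpow_natCast (t ^ (H / 2)),
    ← Real.rpow_mul ht0]
  congr 3
  push_cast
  ring

lemma cV_sq {H : ℝ} (hH0 : 0 < H) (hH : H ≤ 1 / 2) :
    0 ≤ max (c1H H + c2H H) (c3H H) ∧
      cV H ^ 2 = CH H * (3 * max (c1H H + c2H H) (c3H H)) := by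
  have hC := CH_pos hH0 (by linarith : H < 1)
  have hG := Real.Gamma_pos_of_pos (by linarith : 0 < 1 - H)
  have h1 := Gamma_div_le hH0 hH
  have h2 : 0 ≤ max (c1H H + c2H H) (c3H H) := by
    have : 0 ≤ Real.Gamma (1 - H) / H := by positivity
    linarith
  refine ⟨h2, ?_⟩
  rw [cV, Real.sq_sqrt (by positivity)]
  ring

lemma IsStochasticConvolution.eLpNorm_time_le (hV : IsStochasticConvolution P H T W V)
    (hW : IsFractionalNoise P H T W) (hH0 : 0 < H) (hH : H ≤ 1 / 2) {s t : ℝ} (hs : s ∈ Ioc 0 T)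
    (ht : t ∈ Ioc 0 T) (hst : s ≤ t) (x : ℝ) :
    eLpNorm (V t x - V s x) 2 P ≤ ENNReal.ofReal (cV H * |t - s| ^ (H / 2)) := by
  have hH1 : H < 1 := by linarith
  have hts : 0 ≤ t - s := sub_nonneg.2 hst
  have hC := CH_pos hH0 hH1
  refine eLpNorm_two_le_of_sq_le (mul_nonneg (Real.sqrt_nonneg _) (by positivity))
    (((hV t ht x).sub hW (hV s hs x)).eLpNorm_sq_le hW hH0 hH1)
    -- What remains is the comparison of `Γ(1-H)/H` with the bracket in `cV²`.
    ((integrandNormSq_convKernel_time_le hH0 hH1 hs.1 hst x).trans (ENNReal.ofReal_le_ofReal ?_))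
  rw [mul_pow, (cV_sq hH0 hH).2, abs_of_nonneg hts, ← Real.rpow_natCast ((t - s) ^ (H / 2)),
    ← Real.rpow_mul hts, show H / 2 * ((2 : ℕ) : ℝ) = H by push_cast; ring]
  gcongr
  exact Gamma_div_le hH0 hH

lemma IsStochasticConvolution.eLpNorm_space_le (hV : IsStochasticConvolution P H T W V)
    (hW : IsFractionalNoise P H T W) (hH0 : 0 < H) (hH : H ≤ 1 / 2) {t : ℝ} (ht : t ∈ Ioc 0 T)
    (x y : ℝ) :
    eLpNorm (V t x - V t y) 2 P ≤ ENNReal.ofReal (cV H * |x - y| ^ H) := by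
  have hH1 : H < 1 := by linarith
  have hC := CH_pos hH0 hH1
  refine eLpNorm_two_le_of_sq_le (mul_nonneg (Real.sqrt_nonneg _) (by positivity))
    (((hV t ht x).sub hW (hV t ht y)).eLpNorm_sq_le hW hH0 hH1)
    ((integrandNormSq_convKernel_space_le hH0 hH1 ht.1 x y).trans (ENNReal.ofReal_le_ofReal ?_))
  rw [mul_pow, (cV_sq hH0 hH).2, ← Real.rpow_natCast (|x - y| ^ H), ← Real.rpow_mul (abs_nonneg _),
    show H * ((2 : ℕ) : ℝ) = 2 * H by push_cast; ring]
  gcongr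
  have h1 := CH_mul_c3H hH0 hH
  have h2 : CH H * c3H H ≤ CH H * max (c1H H + c2H H) (c3H H) := by
    gcongr
    exact le_max_right _ _
  linarith

lemma IsStochasticConvolution.eLpNorm_sub_le (hV : IsStochasticConvolution P H T W V)
    (hW : IsFractionalNoise P H T W) (hH0 : 0 < H) (hH : H ≤ 1 / 2) {s t : ℝ} (ht : t ∈ Ioc 0 T)
    (hs : s ∈ Ioc 0 T) (x y : ℝ) :
    eLpNorm (fun w => V t x w - V s y w) 2 P
      ≤ ENNReal.ofReal (cV H * (|t - s| ^ (H / 2) + |x - y| ^ H)) := by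
  have hc : 0 ≤ cV H := Real.sqrt_nonneg _
  have h1 : eLpNorm (V t x - V s x) 2 P ≤ ENNReal.ofReal (cV H * |t - s| ^ (H / 2)) := by
    rcases le_total s t with h | h
    · exact hV.eLpNorm_time_le hW hH0 hH hs ht h x
    · rw [← eLpNorm_neg, neg_sub, abs_sub_comm]
      exact hV.eLpNorm_time_le hW hH0 hH ht hs h x
  have h2 := hV.eLpNorm_space_le hW hH0 hH hs x y
  have e : (fun w => V t x w - V s y w) = (V t x - V s x) + (V s x - V s y) := by
    ext w
    simp
  rw [e, mul_add, ENNReal.ofReal_add (by positivity) (by positivity)]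
  -- The path runs through `(s,x)`. Since `cV` bounds the time and the space increment separately,
  -- the triangle inequality costs no further constant.
  exact (eLpNorm_add_le ((hV t ht x).memLp.sub (hV s hs x).memLp).1
    ((hV s hs x).memLp.sub (hV s hs y).memLp).1 one_le_two).trans (add_le_add h1 h2)

end wiener

end FracHeat

end

theorem mainTheorem5 {Ω : Type*} [MeasurableSpace Ω] (P : Measure Ω) [IsProbabilityMeasure P]
    (T : ℝ) (hT : 0 < T)
    (H : ℝ) (hH0 : 0 < H) (hH : H ≤ 1 / 2)
    (W : ℝ → ℝ → Ω → ℝ) (hW : FracHeat.IsFractionalNoise P H T W)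
    (ρ : ℝ) (hρ0 : 0 < ρ) (hρ1 : ρ ≤ 1) (K L₀ : ℝ → ℝ≥0)
    (u₀ : ℝ → Ω → ℝ) (hu₀ : FracHeat.InitialCondition P ρ K L₀ u₀) :
    -- both components of the mild solution are well defined
    (∀ t ∈ Ioc 0 T, ∀ x,
      (∀ᵐ w ∂P, Integrable fun y => FracHeat.heatKernel t (x - y) * u₀ y w) ∧
      MemLp (FracHeat.omegaField u₀ t x) 2 P) ∧
    (∃ V : ℝ → ℝ → Ω → ℝ, FracHeat.IsStochasticConvolution P H T W V) ∧
    -- the bounds for the deterministic-kernel part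
    (∀ t ∈ Ioc 0 T, ∀ x,
      eLpNorm (FracHeat.omegaField u₀ t x) 2 P ≤ ⨆ z, eLpNorm (u₀ z) 2 P) ∧
    (⨆ z, eLpNorm (u₀ z) 2 P) ≤ K 2 ∧
    (∀ t ∈ Ioc 0 T, ∀ s ∈ Ioc 0 T, ∀ x y,
      eLpNorm (fun w => FracHeat.omegaField u₀ t x w - FracHeat.omegaField u₀ s y w) 2 P
        ≤ ENNReal.ofReal
          (FracHeat.cOmega ρ (L₀ 2) * (|t - s| ^ (ρ / 2) + |x - y| ^ ρ))) ∧
    -- the bounds for the stochastic-convolution part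
    (∀ V : ℝ → ℝ → Ω → ℝ, FracHeat.IsStochasticConvolution P H T W V →
      (∀ t ∈ Ioc 0 T, ∀ x,
        eLpNorm (V t x) 2 P ≤ ENNReal.ofReal (FracHeat.AH H * t ^ (H / 2))) ∧
      (∀ t ∈ Ioc 0 T, ∀ s ∈ Ioc 0 T, ∀ x y,
        eLpNorm (fun w => V t x w - V s y w) 2 P
          ≤ ENNReal.ofReal
            (FracHeat.cV H * (|t - s| ^ (H / 2) + |x - y| ^ H)))) := by
  have hH1 : H < 1 := by linarith
  exact ⟨fun t ht x => ⟨hu₀.ae_integrable ht.1 x, hu₀.memLp_omegaField ht.1 x⟩,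
    FracHeat.exists_isStochasticConvolution hW hH0 hH1,
    fun t ht x => hu₀.eLpNorm_omegaField_le ht.1 x,
    hu₀.iSup_eLpNorm_le,
    fun t ht s hs x y => hu₀.eLpNorm_omegaField_sub_le hρ0 hρ1 ht.1 hs.1 x y,
    fun V hV => ⟨fun t ht x => hV.eLpNorm_le hW hH0 hH1 ht x,
      fun t ht s hs x y => hV.eLpNorm_sub_le hW hH0 hH ht hs x y⟩⟩
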